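/- Let $\mathbb{T}$ be the unit circle with normalised arc length measure, let $H^2\subset L^2(\mathbb{T})$ and $H^\infty\subset L^\infty(\mathbb{T})$ be the Hardy spaces of the open unit disk $\mathbb{D}$, and for $\psi\in L^\infty(\mathbb{T})$ let $T_\psi:H^2\to H^2$, $T_\psi f=P_+(\psi f)$, be the Toeplitz operator with symbol $\psi$, where $P_+$ is the orthogonal projection of $L^2(\mathbb{T})$ onto $H^2$. For $b\in H^\infty$ with $\|b\|_{H^\infty}\le 1$, let $\mathcal{H}(b)$ be the de Branges--Rovnyak space, i.e. the image of $H^2$ under $(I-T_bT_{\overline b})^{1/2}$, with the norm that makes $(I-T_bT_{\overline b})^{1/2}$ a partial isometry of $H^2$ onto $\mathcal{H}(b)$. Call $b$ non-extreme if it is not an extreme point of the closed unit ball of $H^\infty$. For $f\in H^2$ and $0<r<1$ write $f_r(z)=f(rz)$ ($z\in\mathbb{D}$). Theorem. Let $\gamma:(0,1)\to(1,\infty)$ be a function such that $\log\gamma(r)=o\bigl((1-r)^{-1}\bigr)$ as $r\to1^-$. Then there exist a non-extreme $b\in H^\infty$ with $\|b\|_{H^\infty}\le 1$, a function $f\in\mathcal{H}(b)$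 and $r_0\in(0,1)$ such that, for all $r\in(r_0,1)$, $f_r\in\mathcal{H}(b)$ and $\|f_r\|_{\mathcal{H}(b)}\ge\gamma(r)$. -/

import Mathlib

open Set Filter Topology MeasureTheory Asymptotics
open scoped ENNReal ComplexConjugate

noncomputable section

namespace DBR

/-- The space `L^p(𝕋)` of the unit circle with normalised arc length measure. The point `t` of
`UnitAddCircle = ℝ/ℤ` stands for `exp (2 π i t)`, so that `fourier n` is the monomial `z ^ n`. -/
abbrev LpT (p : ℝ≥0∞) : Type :=
  Lp ℂ p (AddCircle.haarAddCircle : Measure UnitAddCircle)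

lemma integrable_coe {p : ℝ≥0∞} [hp : Fact (1 ≤ p)] (f : LpT p) :
    Integrable (f : UnitAddCircle → ℂ) AddCircle.haarAddCircle :=
  (Lp.memLp f).integrable hp.out

/-- The `n`-th Fourier coefficient as a linear functional on `L^p(𝕋)`, `p ≥ 1`. -/
def coeff (p : ℝ≥0∞) [Fact (1 ≤ p)] (n : ℤ) : LpT p →ₗ[ℂ] ℂ where
  toFun f := fourierCoeff (f : UnitAddCircle → ℂ) n
  map_add' f g := by
    rw [fourierCoeff_congr_ae (Lp.coeFn_add f g),
      fourierCoeff.add (integrable_coe f) (integrable_coe g)]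
    rfl
  map_smul' c f := by
    rw [fourierCoeff_congr_ae (Lp.coeFn_smul c f), fourierCoeff.const_smul]
    rfl

/-- The Hardy space `H^p`, `p ≥ 1`, as the space of boundary functions: those elements of
`L^p(𝕋)` whose Fourier coefficients of negative index vanish. -/
def hardy (p : ℝ≥0∞) [Fact (1 ≤ p)] : Submodule ℂ (LpT p) where
  carrier := {f | ∀ n : ℤ, n < 0 → coeff p n f = 0}
  add_mem' hf hg n hn := by rw [map_add, hf n hn, hg n hn, add_zero]
  zero_mem' n _ := map_zero _
  smul_mem' c f hf n hn := by rw [map_smul, hf n hn, smul_zero]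

/-- The Hardy space `H^2`. -/
abbrev H2 : Type := hardy 2

/-- The space `H^∞`. -/
abbrev HInf : Type := hardy ∞

lemma coeff_two_eq_inner (n : ℤ) (f : LpT 2) :
    coeff 2 n f = inner ℂ (fourierLp 2 n : LpT 2) f := by
  have h := fourierBasis.repr_apply_apply f n
  rw [fourierBasis_repr, coe_fourierBasis] at h
  exact h

lemma isClosed_hardy_two : IsClosed (hardy 2 : Set (LpT 2)) := by
  have h : (hardy 2 : Set (LpT 2)) =
      ⋂ (n : ℤ) (_ : n < 0), {f | inner ℂ (fourierLp 2 n : LpT 2) f = 0} := by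
    ext f
    simp only [mem_iInter, mem_ofPred_eq, ← coeff_two_eq_inner]
    rfl
  rw [h]
  exact isClosed_biInter fun n _ =>
    isClosed_eq (continuous_const.inner continuous_id) continuous_const

instance : CompleteSpace H2 := isClosed_hardy_two.completeSpace_coe

/-- The multiplication operator `f ↦ ψ f` on `L^2(𝕋)`, for `ψ ∈ L^∞(𝕋)`. -/
def mulOp (ψ : LpT ∞) : LpT 2 →L[ℂ] LpT 2 :=
  (ContinuousLinearMap.mul ℂ ℂ).holderL AddCircle.haarAddCircle ∞ 2 2 ψ

/-- The Toeplitz operator `T_ψ f = P₊ (ψ f)` on `H^2`, where `P₊` is the orthogonal projection of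
`L^2(𝕋)` onto `H^2`. -/
def toeplitz (ψ : LpT ∞) : H2 →L[ℂ] H2 :=
  (hardy 2).orthogonalProjectionOnto ∘L mulOp ψ ∘L (hardy 2).subtypeL

/-- The operator `I - T_b T_{b̄}` on `H^2`. -/
def defect (b : HInf) : H2 →L[ℂ] H2 :=
  1 - toeplitz (b : LpT ∞) ∘L toeplitz (star (b : LpT ∞))

/-- The positive square root of a positive operator on a complex Hilbert space. -/
def opSqrt {H : Type*} [NormedAddCommGroup H] [InnerProductSpace ℂ H] [CompleteSpace H]
    (T : H →L[ℂ] H) : H →L[ℂ] H :=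
  CFC.sqrt T

lemma opSqrt_mul_self {H : Type*} [NormedAddCommGroup H] [InnerProductSpace ℂ H]
    [CompleteSpace H] {T : H →L[ℂ] H} (hT : T.IsPositive) : opSqrt T * opSqrt T = T :=
  CFC.sqrt_mul_sqrt_self T (ContinuousLinearMap.nonneg_iff_isPositive T |>.mpr hT)

lemma opSqrt_isPositive {H : Type*} [NormedAddCommGroup H] [InnerProductSpace ℂ H]
    [CompleteSpace H] (T : H →L[ℂ] H) : (opSqrt T).IsPositive :=
  ContinuousLinearMap.nonneg_iff_isPositive _ |>.mp (CFC.sqrt_nonneg T)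

/-- The operator `(I - T_b T_{b̄})^{1/2}` on `H^2` (the positive square root). -/
def defectSqrt (b : HInf) : H2 →L[ℂ] H2 := opSqrt (defect b)

/-- The de Branges–Rovnyak space `H(b)`, as a set of elements of `H^2`: the image of `H^2` under
`(I - T_b T_{b̄})^{1/2}`. -/
def space (b : HInf) : Submodule ℂ H2 := (defectSqrt b).range

/-- The norm of `H(b)`: it makes `(I - T_b T_{b̄})^{1/2}` a partial isometry of `H^2` onto `H(b)`,
see `hbNorm_defectSqrt`. (Only meaningful for `f` in `H(b)`.) -/
def hbNorm (b : HInf) (f : H2) : ℝ := sInf {x | ∃ g : H2, defectSqrt b g = f ∧ ‖g‖ = x}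

/-- `b` is a non-extreme point of the closed unit ball of `H^∞`. -/
def NonExtreme (b : HInf) : Prop :=
  b ∈ Metric.closedBall (0 : HInf) 1 ∧ b ∉ (Metric.closedBall (0 : HInf) 1).extremePoints ℝ

/-- The value at a point `z` of the open unit disk of the holomorphic extension of `f ∈ H^2`. -/
def eval (f : H2) (z : ℂ) : ℂ := ∑' n : ℕ, coeff 2 n (f : LpT 2) * z ^ n

lemma coeff_fourierLp (m n : ℤ) :
    coeff 2 m (fourierLp 2 n : LpT 2) = if m = n then 1 else 0 := by
  rw [coeff_two_eq_inner]
  exact orthonormal_iff_ite.mp orthonormal_fourier m n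

/-- The monomial `z ^ n` as an element of `H^2`. -/
def monomial (n : ℕ) : H2 :=
  ⟨fourierLp 2 (n : ℤ), fun m hm => by rw [coeff_fourierLp, if_neg (by omega)]⟩

/-- The dilate `f_r` of `f ∈ H^2`, for `|r| < 1`: the element of `H^2` with `f_r(z) = f(rz)`,
see `eval_dilate`. -/
def dilate (f : H2) (r : ℝ) : H2 := ∑' n : ℕ, (coeff 2 n (f : LpT 2) * (r : ℂ) ^ n) • monomial n

/-! ### The definitions have the intended properties -/

lemma norm_monomial (n : ℕ) : ‖monomial n‖ = 1 :=
  orthonormal_fourier.1 (n : ℤ)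

lemma norm_coeff_le (f : H2) (n : ℤ) : ‖coeff 2 n (f : LpT 2)‖ ≤ ‖f‖ := by
  rw [coeff_two_eq_inner]
  refine (norm_inner_le_norm _ _).trans ?_
  rw [orthonormal_fourier.1 n, one_mul]
  rfl

lemma summable_coeff (f : H2) {z : ℂ} (hz : ‖z‖ < 1) :
    Summable fun n : ℕ => ‖coeff 2 n (f : LpT 2) * z ^ n‖ := by
  refine Summable.of_nonneg_of_le (fun _ => norm_nonneg _) (fun n => ?_)
    ((summable_geometric_of_lt_one (norm_nonneg z) hz).mul_left ‖f‖)
  rw [norm_mul, norm_pow]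
  exact mul_le_mul_of_nonneg_right (norm_coeff_le f n) (by positivity)

lemma coeff_dilate (f : H2) {r : ℝ} (hr : |r| < 1) (m : ℕ) :
    coeff 2 m (dilate f r : LpT 2) = coeff 2 m (f : LpT 2) * (r : ℂ) ^ m := by
  have hs : Summable fun n : ℕ => (coeff 2 n (f : LpT 2) * (r : ℂ) ^ n) • monomial n := by
    refine Summable.of_norm ?_
    simpa only [norm_smul, norm_monomial, mul_one] using
      summable_coeff f (z := (r : ℂ)) (by simpa using hr)
  have h := hs.hasSum.mapL
    ((innerSL ℂ (fourierLp 2 (m : ℤ) : LpT 2)) ∘L (hardy 2).subtypeL)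
  have e : (fun n : ℕ => ((innerSL ℂ (fourierLp 2 (m : ℤ) : LpT 2)) ∘L (hardy 2).subtypeL)
      ((coeff 2 n (f : LpT 2) * (r : ℂ) ^ n) • monomial n)) =
      fun n : ℕ => if n = m then coeff 2 m (f : LpT 2) * (r : ℂ) ^ m else 0 := by
    funext n
    rw [map_smul]
    change _ • inner ℂ (fourierLp 2 (m : ℤ) : LpT 2) (fourierLp 2 (n : ℤ) : LpT 2) = _
    rw [← coeff_two_eq_inner, coeff_fourierLp]
    by_cases hnm : n = m
    · subst hnm; simp
    · simp [hnm, Ne.symm hnm]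
  rw [e] at h
  rw [coeff_two_eq_inner]
  exact h.unique (hasSum_ite_eq m _)

/-- `f_r(z) = f(rz)`. -/
theorem eval_dilate (f : H2) {r : ℝ} (hr : |r| < 1) (z : ℂ) :
    eval (dilate f r) z = eval f (r * z) := by
  refine tsum_congr fun n => ?_
  rw [coeff_dilate f hr, mul_pow, mul_assoc]

lemma mulOp_coe (ψ : LpT ∞) (f : LpT 2) :
    mulOp ψ f =ᵐ[AddCircle.haarAddCircle] fun t => ψ t * f t :=
  ContinuousLinearMap.coeFn_holder _ ψ f

lemma norm_mulOp_le (ψ : LpT ∞) (f : LpT 2) : ‖mulOp ψ f‖ ≤ ‖ψ‖ * ‖f‖ := by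
  refine (ContinuousLinearMap.norm_holder_apply_apply_le (ContinuousLinearMap.mul ℂ ℂ) ψ f).trans ?_
  rw [ContinuousLinearMap.opNorm_mul, one_mul]

lemma inner_mulOp (ψ : LpT ∞) (f g : LpT 2) :
    inner ℂ (mulOp ψ f) g = inner ℂ f (mulOp (star ψ) g) := by
  rw [L2.inner_def, L2.inner_def]
  refine integral_congr_ae ?_
  filter_upwards [mulOp_coe ψ f, mulOp_coe (star ψ) g, Lp.coeFn_star ψ] with t h1 h2 h3
  rw [h1, h2, h3]
  simp only [RCLike.inner_apply', Pi.star_apply, RCLike.star_def, map_mul]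
  ring

lemma norm_toeplitz_apply_le (ψ : LpT ∞) (f : H2) : ‖toeplitz ψ f‖ ≤ ‖ψ‖ * ‖f‖ :=
  ((hardy 2).norm_orthogonalProjectionOnto_apply_le _).trans (norm_mulOp_le ψ f)

/-- The adjoint of `T_ψ` is `T_{ψ̄}`. -/
lemma inner_toeplitz (ψ : LpT ∞) (f g : H2) :
    inner ℂ (toeplitz ψ f) g = inner ℂ f (toeplitz (star ψ) g) := by
  change inner ℂ ((hardy 2).orthogonalProjectionOnto (mulOp ψ f)) g =
    inner ℂ f ((hardy 2).orthogonalProjectionOnto (mulOp (star ψ) g))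
  rw [Submodule.inner_orthogonalProjectionOnto_eq_of_mem_right,
    Submodule.inner_orthogonalProjectionOnto_eq_of_mem_left]
  exact inner_mulOp ψ f g

/-- `I - T_b T_{b̄}` is a positive operator, so that `defectSqrt` is its positive square root. -/
theorem defect_isPositive (b : HInf) (hb : ‖b‖ ≤ 1) : (defect b).IsPositive := by
  rw [ContinuousLinearMap.isPositive_iff_complex]
  intro f
  have key : inner ℂ (defect b f) f =
      ((‖f‖ ^ 2 - ‖toeplitz (star (b : LpT ∞)) f‖ ^ 2 : ℝ) : ℂ) := by
    change inner ℂ (f - toeplitz (b : LpT ∞) (toeplitz (star (b : LpT ∞)) f)) f = _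
    rw [inner_sub_left, inner_toeplitz]
    erw [inner_self_eq_norm_sq_to_K (𝕜 := ℂ) f,
      inner_self_eq_norm_sq_to_K (𝕜 := ℂ) (toeplitz (star (b : LpT ∞)) f)]
    push_cast
    rfl
  have hn : ‖toeplitz (star (b : LpT ∞)) f‖ ≤ ‖f‖ := by
    refine (norm_toeplitz_apply_le _ f).trans ?_
    have : ‖star (b : LpT ∞)‖ ≤ 1 := by
      have e : ‖star (b : LpT ∞)‖ = ‖(b : LpT ∞)‖ := by
        rw [Lp.norm_def, Lp.norm_def]
        congr 1
        refine eLpNorm_congr_norm_ae ?_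
        filter_upwards [Lp.coeFn_star (b : LpT ∞)] with t ht
        rw [ht, Pi.star_apply, norm_star]
      rw [e]; exact hb
    nlinarith [norm_nonneg f]
  rw [key]
  refine ⟨rfl, ?_⟩
  have := norm_nonneg (toeplitz (star (b : LpT ∞)) f)
  change 0 ≤ ‖f‖ ^ 2 - ‖toeplitz (star (b : LpT ∞)) f‖ ^ 2
  nlinarith

theorem defectSqrt_mul_self (b : HInf) (hb : ‖b‖ ≤ 1) :
    defectSqrt b * defectSqrt b = defect b :=
  opSqrt_mul_self (defect_isPositive b hb)

/-- The defining property of the norm of `H(b)`. -/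
theorem hbNorm_defectSqrt (b : HInf) (g : H2) (hg : g ∈ (defectSqrt b).kerᗮ) :
    hbNorm b (defectSqrt b g) = ‖g‖ := by
  refine IsLeast.csInf_eq ⟨⟨g, rfl, rfl⟩, ?_⟩
  rintro x ⟨g', hg', rfl⟩
  have hk : g' - g ∈ (defectSqrt b).ker := by
    rw [LinearMap.mem_ker, map_sub]
    exact sub_eq_zero.mpr hg'
  have h0 : inner ℂ g (g' - g) = 0 := Submodule.inner_left_of_mem_orthogonal hk hg
  have := norm_add_sq_eq_norm_sq_add_norm_sq_of_inner_eq_zero g (g' - g) h0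
  rw [add_sub_cancel] at this
  nlinarith [norm_nonneg g, norm_nonneg g', norm_nonneg (g' - g)]

end DBR

end

/-! Write D for I - T_b T_b̄. Two facts govern H(b): f belongs to it as soon as |⟨f, x⟩| ≤ C
‖D^{1/2} x‖ for all x (`mem_space_of_norm_inner_le`), and ‖f‖_b ≥ |⟨f, x⟩| whenever ‖D^{1/2} x‖ ≤ 1
(`norm_inner_le_hbNorm_mul`).

Take b = B² exp(-q), where B is the Blaschke product with zeros w_j = 1 - 8^{-j}, and Re q = |A|² on
the circle for a small disc algebra function A without zeros in the disc; thus |b| = exp(-|A|²) a.e.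
Take f = ∑ 8^{-2j} k_{w_j}. Since T_b̄ k_w = conj(b(w)) k_w (`toeplitz_star_ker`), T_b̄ f = 0, so Df
= f and f is in H(b). Dilation moves the nodes off the zeros: f_r = ∑ 8^{-2j} k_{r w_j}. It stays in
H(b) because |A|² + |b|² ≤ 1 gives ‖Ax‖ ≤ ‖D^{1/2} x‖, and 1/A is bounded on |z| ≤ r
(`kerSum_mem_space`).

For the lower bound, test f_r against x = b y with y = exp(2^{-n}/(1 + δ_n - z)). Then ‖D^{1/2} x‖²
≤ ∫ (1 - |b|²)|y|² ≤ 2 ∫ |Ay|² (`norm_defectSqrt_toeplitz_le`), and A = (1 - z)⁴ exp(-∑ 2^{-n}/(1 +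
δ_n - z))/32 is small enough that |Ay| ≤ 1/2 for every n at once (`exists_mate`). On the real axis b
≥ 0 and y > 0, so ⟨f_r, x⟩ is a sum of nonnegative terms and dominates each of them. There is a j
with 8^{-j} comparable to 1 - r and r w_j far from all zeros (`exists_good_zero`); its term is at
least c (1 - r)² exp(2^{-n}/(3(1 - r))) once δ_n ≤ 1 - r. The little-o hypothesis leaves room to
choose δ_n so that, for each r near 1, some n makes this exceed γ(r) (`exists_delta`). -/

noncomputable section

namespace DBR

/-! ### Boundary functions and reproducing kernels. -/

/-- The point of the unit circle in `ℂ` corresponding to `t`. -/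
def circ (t : UnitAddCircle) : ℂ := (AddCircle.toCircle t : ℂ)

lemma norm_circ (t : UnitAddCircle) : ‖circ t‖ = 1 := Circle.norm_coe _

lemma continuous_circ : Continuous circ :=
  continuous_subtype_val.comp AddCircle.continuous_toCircle

lemma fourier_eq_zpow (n : ℤ) (t : UnitAddCircle) : fourier n t = circ t ^ n := by
  rw [fourier_apply, AddCircle.toCircle_zsmul, circ]
  exact Circle.coe_zpow _ _

lemma circ_mul_conj (t : UnitAddCircle) : circ t * conj (circ t) = 1 := by
  rw [Complex.mul_conj, Complex.normSq_eq_norm_sq, norm_circ]; simp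

lemma inv_circ (t : UnitAddCircle) : (circ t)⁻¹ = conj (circ t) :=
  inv_eq_of_mul_eq_one_right (circ_mul_conj t)

/-- The zeros of the Blaschke product accumulate at 1, where nothing is controlled, so points must
be null. The circle is nontrivial because 1/2 is sent to -1. -/
instance : NullSingletonClass (AddCircle.haarAddCircle : Measure UnitAddCircle) := by
  have : Nontrivial UnitAddCircle := ⟨((2⁻¹ : ℝ) : UnitAddCircle), 0, fun h => by
    have h2 := congrArg (fun x : UnitAddCircle => ((AddCircle.toCircle x : Circle) : ℂ)) h
    simp only [AddCircle.toCircle_zero, AddCircle.toCircle_apply_mk, Circle.coe_exp] at h2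
    have h3 : (2 * Real.pi / (1 : ℝ) * 2⁻¹ : ℝ) = Real.pi := by ring
    rw [h3, Complex.exp_pi_mul_I] at h2
    norm_num at h2⟩
  have : (𝓝[≠] (0 : UnitAddCircle)).NeBot := inferInstance
  infer_instance

lemma ae_circ_ne_one : ∀ᵐ t ∂(AddCircle.haarAddCircle : Measure UnitAddCircle), circ t ≠ 1 := by
  have h : ({0}ᶜ : Set UnitAddCircle) ∈ ae (AddCircle.haarAddCircle : Measure UnitAddCircle) :=
    compl_mem_ae_iff.mpr (measure_singleton 0)
  filter_upwards [h] with t ht h1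
  refine ht ?_
  refine AddCircle.injective_toCircle one_ne_zero ?_
  rw [AddCircle.toCircle_zero]
  exact Subtype.ext h1

lemma integral_circ (G : ℂ → ℂ) :
    ∫ t, G (circ t) ∂(AddCircle.haarAddCircle : Measure UnitAddCircle) =
      Real.circleAverage G 0 1 := by
  have h := fourierCoeff_eq_intervalIntegral (T := 1) (fun t => G (circ t)) 0 0
  simp only [fourierCoeff, neg_zero, fourier_zero, one_smul, div_one, zero_add] at h
  rw [h, Real.circleAverage_def]
  have h2 := intervalIntegral.integral_comp_mul_left (a := 0) (b := 1)
    (fun θ => G (circleMap 0 1 θ)) (c := 2 * Real.pi) (by positivity)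
  simp only [mul_zero, mul_one] at h2
  rw [← h2]
  refine intervalIntegral.integral_congr fun x _ => ?_
  simp only [circ, AddCircle.toCircle_apply_mk, Circle.coe_exp, circleMap]
  simp

/-- Cauchy's formula, as a pairing with the reproducing kernel of `H²`. -/
lemma integral_mul_conj_kernel {G : ℂ → ℂ} (hG : DiffContOnCl ℂ G (Metric.ball 0 1)) {w : ℂ}
    (hw : ‖w‖ < 1) :
    ∫ t, G (circ t) * conj ((1 - conj w * circ t)⁻¹)
      ∂(AddCircle.haarAddCircle : Measure UnitAddCircle) = G w := by
  have e : ∀ t, G (circ t) * conj ((1 - conj w * circ t)⁻¹) =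
      (fun z => z * ((z - w)⁻¹ * G z)) (circ t) := by
    intro t
    have h0 : circ t ≠ 0 := fun h => by simpa [h] using norm_circ t
    have h1 : circ t - w ≠ 0 := fun h => by
      rw [sub_eq_zero] at h; rw [← h, norm_circ] at hw; exact lt_irrefl _ hw
    have h2 : conj ((1 - conj w * circ t)⁻¹) = circ t * (circ t - w)⁻¹ := by
      rw [map_inv₀, map_sub, map_mul, map_one, Complex.conj_conj, ← inv_circ]
      field_simp
    rw [h2]; ring
  simp_rw [e]
  rw [integral_circ (fun z => z * ((z - w)⁻¹ * G z)),
    Real.circleAverage_eq_circleIntegral one_ne_zero,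
    ← hG.two_pi_i_inv_smul_circleIntegral_sub_inv_smul (w := w) (by simpa using hw)]
  congr 1
  refine circleIntegral.integral_congr zero_le_one fun z hz => ?_
  have : z ≠ 0 := fun h => by simp [h] at hz
  simp only [sub_zero, smul_eq_mul]
  field_simp

/-- `F` is a bounded pointwise limit, on the closed unit disc without the point `1`, of
functions in the disc algebra. -/
def BddLim (F : ℂ → ℂ) : Prop :=
  ∃ (M : ℝ) (u : ℕ → ℂ → ℂ), (∀ N, DiffContOnCl ℂ (u N) (Metric.ball 0 1)) ∧
    (∀ N z, ‖z‖ ≤ 1 → ‖u N z‖ ≤ M) ∧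
    ∀ z, ‖z‖ ≤ 1 → z ≠ 1 → Tendsto (fun N => u N z) atTop (𝓝 (F z))

lemma exists_bound {G : ℂ → ℂ} (hG : DiffContOnCl ℂ G (Metric.ball 0 1)) :
    ∃ M, ∀ z, ‖z‖ ≤ 1 → ‖G z‖ ≤ M := by
  obtain ⟨M, hM⟩ := (isCompact_closedBall (0 : ℂ) 1).exists_bound_of_continuousOn
    hG.continuousOn_ball
  exact ⟨M, fun z hz => hM z (by simpa using hz)⟩

lemma _root_.DiffContOnCl.bddLim {G : ℂ → ℂ} (hG : DiffContOnCl ℂ G (Metric.ball 0 1)) :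
    BddLim G := by
  obtain ⟨M, hM⟩ := exists_bound hG
  exact ⟨M, fun _ => G, fun _ => hG, fun _ => hM, fun _ _ _ => tendsto_const_nhds⟩

lemma diffContOnCl_mul {F G : ℂ → ℂ} (hF : DiffContOnCl ℂ F (Metric.ball 0 1))
    (hG : DiffContOnCl ℂ G (Metric.ball 0 1)) :
    DiffContOnCl ℂ (fun z => F z * G z) (Metric.ball 0 1) :=
  ⟨hF.1.mul hG.1, hF.2.mul hG.2⟩

lemma BddLim.mul {F G : ℂ → ℂ} (hF : BddLim F) (hG : DiffContOnCl ℂ G (Metric.ball 0 1)) :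
    BddLim fun z => F z * G z := by
  obtain ⟨M, u, hu, hM, hl⟩ := hF
  obtain ⟨K, hK⟩ := exists_bound hG
  refine ⟨M * K, fun N z => u N z * G z, fun N => diffContOnCl_mul (hu N) hG, fun N z hz => ?_,
    fun z hz h1 => (hl z hz h1).mul_const _⟩
  rw [norm_mul]
  exact mul_le_mul (hM N z hz) (hK z hz) (norm_nonneg _) ((norm_nonneg _).trans (hM N z hz))

lemma continuous_comp_circ {G : ℂ → ℂ} (hG : DiffContOnCl ℂ G (Metric.ball 0 1)) :
    Continuous fun t => G (circ t) := by
  refine hG.continuousOn_ball.comp_continuous continuous_circ fun t => ?_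
  simp [norm_circ]

lemma BddLim.aestronglyMeasurable {F : ℂ → ℂ} (hF : BddLim F) :
    AEStronglyMeasurable (fun t => F (circ t))
      (AddCircle.haarAddCircle : Measure UnitAddCircle) := by
  obtain ⟨M, u, hu, hM, hl⟩ := hF
  refine aestronglyMeasurable_of_tendsto_ae atTop
    (fun N => (continuous_comp_circ (hu N)).aestronglyMeasurable) ?_
  filter_upwards [ae_circ_ne_one] with t ht
  exact hl _ (norm_circ t).le ht

lemma BddLim.memLp {F : ℂ → ℂ} (hF : BddLim F) (p : ℝ≥0∞) :
    MemLp (fun t => F (circ t)) p (AddCircle.haarAddCircle : Measure UnitAddCircle) := by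
  have hm := hF.aestronglyMeasurable
  obtain ⟨M, u, hu, hM, hl⟩ := hF
  refine MemLp.of_bound hm M ?_
  filter_upwards [ae_circ_ne_one] with t ht
  exact le_of_tendsto (hl _ (norm_circ t).le ht).norm
    (Eventually.of_forall fun N => hM N _ (norm_circ t).le)

lemma one_sub_mul_ne_zero {w z : ℂ} (hw : ‖w‖ < 1) (hz : ‖z‖ ≤ 1) : 1 - w * z ≠ 0 := by
  intro h
  have h1 : ‖w * z‖ = 1 := by rw [← sub_eq_zero.mp h, norm_one]
  rw [norm_mul] at h1
  nlinarith [norm_nonneg w, norm_nonneg z]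

lemma diffContOnCl_kernel {w : ℂ} (hw : ‖w‖ < 1) :
    DiffContOnCl ℂ (fun z => (1 - w * z)⁻¹) (Metric.ball 0 1) := by
  refine DifferentiableOn.diffContOnCl (fun z hz => ?_)
  rw [closure_ball _ one_ne_zero] at hz
  refine DifferentiableAt.differentiableWithinAt ?_
  exact DifferentiableAt.inv (by fun_prop) (one_sub_mul_ne_zero hw (by simpa using hz))

/-- Dominated convergence from the disc algebra: the exceptional point 1 is null on the circle and
is not a point w of the open disc. -/
lemma BddLim.integral_mul_conj_kernel {F : ℂ → ℂ} (hF : BddLim F) {w : ℂ} (hw : ‖w‖ < 1) :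
    ∫ t, F (circ t) * conj ((1 - conj w * circ t)⁻¹)
      ∂(AddCircle.haarAddCircle : Measure UnitAddCircle) = F w := by
  obtain ⟨M, u, hu, hM, hl⟩ := hF
  have hk : DiffContOnCl ℂ (fun z => (1 - conj w * z)⁻¹) (Metric.ball 0 1) :=
    diffContOnCl_kernel (by simpa using hw)
  obtain ⟨K, hK⟩ := exists_bound hk
  have hc : Continuous fun t => conj ((1 - conj w * circ t)⁻¹) :=
    Complex.continuous_conj.comp (continuous_comp_circ hk)
  have h1 := tendsto_integral_of_dominated_convergence
    (μ := (AddCircle.haarAddCircle : Measure UnitAddCircle))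
    (F := fun N t => u N (circ t) * conj ((1 - conj w * circ t)⁻¹))
    (f := fun t => F (circ t) * conj ((1 - conj w * circ t)⁻¹)) (fun _ => M * K)
    (fun N => ((continuous_comp_circ (hu N)).mul hc).aestronglyMeasurable)
    (integrable_const _) (fun N => Eventually.of_forall fun t => by
      rw [norm_mul, RCLike.norm_conj]
      exact mul_le_mul (hM N _ (norm_circ t).le) (hK _ (norm_circ t).le) (norm_nonneg _)
        ((norm_nonneg _).trans (hM N _ (norm_circ t).le))) (by
      filter_upwards [ae_circ_ne_one] with t ht
      exact (hl _ (norm_circ t).le ht).mul_const _)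
  simp_rw [fun N => DBR.integral_mul_conj_kernel (hu N) hw] at h1
  refine tendsto_nhds_unique h1 (hl w hw.le ?_)
  rintro rfl
  simp at hw

lemma diffContOnCl_pow (n : ℕ) : DiffContOnCl ℂ (fun z : ℂ => z ^ n) (Metric.ball 0 1) :=
  (differentiable_pow n).diffContOnCl

lemma BddLim.integral {F : ℂ → ℂ} (hF : BddLim F) :
    ∫ t, F (circ t) ∂(AddCircle.haarAddCircle : Measure UnitAddCircle) = F 0 := by
  simpa using hF.integral_mul_conj_kernel (w := 0) (by simp)

/-- The boundary function of `F`, as an element of `L^p(𝕋)`. -/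
def bdry {F : ℂ → ℂ} (hF : BddLim F) (p : ℝ≥0∞) : LpT p := (hF.memLp p).toLp _

lemma bdry_coe {F : ℂ → ℂ} (hF : BddLim F) (p : ℝ≥0∞) :
    bdry hF p =ᵐ[AddCircle.haarAddCircle] fun t => F (circ t) := MemLp.coeFn_toLp _

lemma bdry_mem_hardy {F : ℂ → ℂ} (hF : BddLim F) (p : ℝ≥0∞) [Fact (1 ≤ p)] :
    bdry hF p ∈ hardy p := by
  intro n hn
  obtain ⟨m, rfl⟩ : ∃ m : ℕ, n = -(m + 1 : ℕ) := ⟨(-n - 1).toNat, by omega⟩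
  change fourierCoeff _ _ = 0
  rw [fourierCoeff_congr_ae (bdry_coe hF p), fourierCoeff]
  simp_rw [neg_neg, fourier_eq_zpow, zpow_natCast, smul_eq_mul, mul_comm]
  rw [(hF.mul (diffContOnCl_pow (m + 1))).integral]
  simp

/-- The boundary function of `F`, as an element of `H^p`. -/
def bdryH {F : ℂ → ℂ} (hF : BddLim F) (p : ℝ≥0∞) [Fact (1 ≤ p)] : hardy p :=
  ⟨bdry hF p, bdry_mem_hardy hF p⟩

lemma coeff_bdry_zero {F : ℂ → ℂ} (hF : BddLim F) (p : ℝ≥0∞) [Fact (1 ≤ p)] :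
    coeff p 0 (bdry hF p) = F 0 := by
  change fourierCoeff _ _ = _
  rw [fourierCoeff_congr_ae (bdry_coe hF p), fourierCoeff]
  simp_rw [neg_zero, fourier_zero, one_smul]
  exact hF.integral

/-- The reproducing kernel `k_w(z) = (1 - w̄ z)⁻¹` of `H²`. -/
def ker (w : ℂ) (hw : ‖w‖ < 1) : H2 :=
  bdryH (diffContOnCl_kernel (w := conj w) (by simpa using hw)).bddLim 2

lemma ker_coe (w : ℂ) (hw : ‖w‖ < 1) :
    ((ker w hw : H2) : LpT 2) =ᵐ[AddCircle.haarAddCircle] fun t => (1 - conj w * circ t)⁻¹ :=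
  bdry_coe _ _

lemma H2_ext {f g : H2} (h : ∀ n : ℕ, coeff 2 n (f : LpT 2) = coeff 2 n (g : LpT 2)) : f = g := by
  refine Subtype.ext (fourierBasis.repr.injective (lp.ext (funext fun n => ?_)))
  rw [fourierBasis_repr, fourierBasis_repr]
  rcases lt_or_ge n 0 with hn | hn
  · exact (f.2 n hn).trans (g.2 n hn).symm
  · obtain ⟨m, rfl⟩ := Int.eq_ofNat_of_zero_le hn
    exact h m

lemma coeff_eq_inner_monomial (n : ℕ) (f : H2) :
    coeff 2 n (f : LpT 2) = inner ℂ (monomial n) f := coeff_two_eq_inner _ _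

lemma inner_ker_bdryH {F : ℂ → ℂ} (hF : BddLim F) {w : ℂ} (hw : ‖w‖ < 1) :
    inner ℂ (ker w hw) (bdryH hF 2) = F w := by
  change inner ℂ ((ker w hw : H2) : LpT 2) (bdry hF 2) = F w
  rw [L2.inner_def, ← hF.integral_mul_conj_kernel hw]
  refine integral_congr_ae ?_
  filter_upwards [ker_coe w hw, bdry_coe hF 2] with t h1 h2
  rw [h1, h2, RCLike.inner_apply', mul_comm]

lemma monomial_eq (n : ℕ) : monomial n = bdryH (diffContOnCl_pow n).bddLim 2 := by
  refine Subtype.ext (Lp.ext ?_)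
  filter_upwards [coeFn_fourierLp 2 (n : ℤ), bdry_coe (diffContOnCl_pow n).bddLim 2] with t h1 h2
  change (fourierLp 2 (n : ℤ) : LpT 2) t = bdry (diffContOnCl_pow n).bddLim 2 t
  rw [h1, h2, fourier_eq_zpow, zpow_natCast]

lemma coeff_ker (w : ℂ) (hw : ‖w‖ < 1) (n : ℕ) :
    coeff 2 n ((ker w hw : H2) : LpT 2) = conj w ^ n := by
  rw [coeff_eq_inner_monomial, monomial_eq]
  refine (inner_conj_symm (𝕜 := ℂ) (E := H2) _ _).symm.trans ?_
  rw [inner_ker_bdryH, map_pow]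

lemma norm_hardy_le_of_ae {p : ℝ≥0∞} [Fact (1 ≤ p)] {f : hardy p} {C : ℝ} (hC : 0 ≤ C)
    (h : ∀ᵐ t ∂(AddCircle.haarAddCircle : Measure UnitAddCircle), ‖(f : LpT p) t‖ ≤ C) :
    ‖f‖ ≤ C := by
  have := Lp.norm_le_of_ae_bound hC h
  rw [show measureUnivNNReal (AddCircle.haarAddCircle : Measure UnitAddCircle) = 1 by
    simp [measureUnivNNReal]] at this
  simpa using this

lemma norm_ker_le (w : ℂ) (hw : ‖w‖ < 1) : ‖ker w hw‖ ≤ (1 - ‖w‖)⁻¹ := by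
  refine norm_hardy_le_of_ae (inv_nonneg.mpr (by linarith)) ?_
  filter_upwards [ker_coe w hw] with t ht
  rw [ht, norm_inv]
  refine inv_anti₀ (by linarith) ?_
  have := norm_sub_norm_le (1 : ℂ) (conj w * circ t)
  rwa [norm_one, norm_mul, RCLike.norm_conj, norm_circ, mul_one] at this

/-- Adjoints of analytic Toeplitz operators act diagonally on kernels. -/
lemma toeplitz_star_ker {F : ℂ → ℂ} (hF : BddLim F) {w : ℂ} (hw : ‖w‖ < 1) :
    toeplitz (star (bdry hF ∞)) (ker w hw) = conj (F w) • ker w hw := by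
  -- Compare Taylor coefficients: ⟨zⁿ, T_F̄ k_w⟩ = ⟨F zⁿ, k_w⟩ = conj(F(w) wⁿ).
  refine H2_ext fun n => ?_
  have h : coeff 2 n ((conj (F w) • ker w hw : H2) : LpT 2) = conj (F w) * conj w ^ n := by
    rw [← coeff_ker w hw]
    exact map_smul _ _ _
  rw [h, coeff_eq_inner_monomial, ← inner_toeplitz]
  change inner ℂ ((hardy 2).orthogonalProjectionOnto (mulOp _ (monomial n))) (ker w hw) = _
  rw [Submodule.inner_orthogonalProjectionOnto_eq_of_mem_right, ← map_pow, ← map_mul,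
    ← (hF.mul (diffContOnCl_pow n)).integral_mul_conj_kernel hw, L2.inner_def, ← integral_conj]
  refine integral_congr_ae ?_
  filter_upwards [mulOp_coe (bdry hF ∞) (monomial n), bdry_coe hF ∞, ker_coe w hw,
    coeFn_fourierLp 2 (n : ℤ)] with t h1 h2 h3 h4
  have h5 : ((monomial n : H2) : LpT 2) t = circ t ^ n := by
    refine h4.trans ?_
    rw [fourier_eq_zpow, zpow_natCast]
  rw [h1, h2, h3, h5, RCLike.inner_apply']
  simp

/-! ### Membership in H(b) and bounds for its norm by duality. -/

section Hilbert

variable {H : Type*} [NormedAddCommGroup H] [InnerProductSpace ℂ H] [CompleteSpace H]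

/-- Douglas' range criterion for self-adjoint operators. -/
lemma mem_range_of_norm_inner_le {T : H →L[ℂ] H} (hT : ∀ x y, inner ℂ (T x) y = inner ℂ x (T y))
    {f : H} {C : ℝ} (hf : ∀ x, ‖inner ℂ f x‖ ≤ C * ‖T x‖) : ∃ g, T g = f := by
  let T' : H →ₗ[ℂ] H := T
  -- By the bound, T x ↦ ⟨f, x⟩ is well defined and bounded on the range of T; extend it by
  -- Hahn–Banach and represent it by a vector g, so that ⟨T g, x⟩ = ⟨g, T x⟩ = ⟨f, x⟩.
  have hk : LinearMap.ker T' ≤ LinearMap.ker (innerSL ℂ f : H →ₗ[ℂ] ℂ) := by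
    intro x hx
    have hx' : T x = 0 := hx
    have := hf x
    rw [hx', norm_zero, mul_zero] at this
    exact norm_le_zero_iff.mp this
  let l0 : LinearMap.range T' →ₗ[ℂ] ℂ :=
    ((LinearMap.ker T').liftQ (innerSL ℂ f : H →ₗ[ℂ] ℂ) hk) ∘ₗ
      (T'.quotKerEquivRange.symm : LinearMap.range T' →ₗ[ℂ] _)
  have hl0 : ∀ x, l0 ⟨T' x, x, rfl⟩ = inner ℂ f x := by
    intro x
    have : T'.quotKerEquivRange.symm ⟨T' x, x, rfl⟩ = (LinearMap.ker T').mkQ x :=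
      T'.quotKerEquivRange_symm_apply_image x ⟨x, rfl⟩
    simp only [l0, LinearMap.comp_apply, LinearEquiv.coe_coe]
    rw [this]
    rfl
  let l : StrongDual ℂ (LinearMap.range T') := l0.mkContinuous C (by
    rintro ⟨_, x, rfl⟩
    rw [hl0]
    exact hf x)
  obtain ⟨L, hL, -⟩ := exists_extension_norm_eq (LinearMap.range T') l
  refine ⟨(InnerProductSpace.toDual ℂ H).symm L, ext_inner_right ℂ fun x => ?_⟩
  rw [hT, InnerProductSpace.toDual_symm_apply]
  exact (hL ⟨T' x, x, rfl⟩).trans (hl0 x)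

end Hilbert

lemma inner_defectSqrt (b : HInf) (x y : H2) :
    inner ℂ (defectSqrt b x) y = inner ℂ x (defectSqrt b y) :=
  (opSqrt_isPositive (defect b)).isSymmetric x y

lemma norm_defectSqrt_sq (b : HInf) (hb : ‖b‖ ≤ 1) (x : H2) :
    ‖defectSqrt b x‖ ^ 2 = ‖x‖ ^ 2 - ‖toeplitz (star (b : LpT ∞)) x‖ ^ 2 := by
  have h1 : inner ℂ (defectSqrt b x) (defectSqrt b x) = inner ℂ (defect b x) x := by
    rw [← inner_defectSqrt, ← defectSqrt_mul_self b hb]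
    rfl
  have h2 : inner ℂ (defect b x) x =
      ((‖x‖ ^ 2 - ‖toeplitz (star (b : LpT ∞)) x‖ ^ 2 : ℝ) : ℂ) := by
    change inner ℂ (x - toeplitz (b : LpT ∞) (toeplitz (star (b : LpT ∞)) x)) x = _
    rw [inner_sub_left, inner_toeplitz]
    erw [inner_self_eq_norm_sq_to_K (𝕜 := ℂ) x,
      inner_self_eq_norm_sq_to_K (𝕜 := ℂ) (toeplitz (star (b : LpT ∞)) x)]
    push_cast
    rfl
  have h3 := (inner_self_eq_norm_sq_to_K (𝕜 := ℂ) (E := H2) (defectSqrt b x)).symm.trans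
    (h1.trans h2)
  rw [← Complex.ofReal_inj, ← h3]
  exact Complex.ofReal_pow _ _

lemma mem_space_of_norm_inner_le {b : HInf} {f : H2} {C : ℝ}
    (hf : ∀ x, ‖inner ℂ f x‖ ≤ C * ‖defectSqrt b x‖) : f ∈ space b := by
  obtain ⟨g, hg⟩ := mem_range_of_norm_inner_le (inner_defectSqrt b) hf
  exact ⟨g, hg⟩

lemma mem_space_of_toeplitz_star_eq_zero {b : HInf} (hb : ‖b‖ ≤ 1) {f : H2}
    (hf : toeplitz (star (b : LpT ∞)) f = 0) : f ∈ space b := by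
  refine ⟨defectSqrt b f, ?_⟩
  change (defectSqrt b * defectSqrt b) f = f
  rw [defectSqrt_mul_self b hb]
  change f - toeplitz (b : LpT ∞) (toeplitz (star (b : LpT ∞)) f) = f
  rw [hf, map_zero, sub_zero]

/-- For every preimage g of f, ⟨f, x⟩ = ⟨g, D^{1/2} x⟩ is at most ‖g‖ in modulus. -/
lemma norm_inner_le_hbNorm_mul {b : HInf} {f : H2} (hf : f ∈ space b) (x : H2)
    (hx : ‖defectSqrt b x‖ ≤ 1) : ‖inner ℂ f x‖ ≤ hbNorm b f := by
  obtain ⟨g, hg⟩ := hf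
  refine le_csInf ⟨‖g‖, g, hg, rfl⟩ ?_
  rintro _ ⟨g, rfl, rfl⟩
  rw [inner_defectSqrt]
  refine (norm_inner_le_norm (𝕜 := ℂ) (E := H2) _ _).trans ?_
  exact mul_le_of_le_one_right (norm_nonneg _) hx

lemma norm_sq_eq_integral (f : LpT 2) :
    ‖f‖ ^ 2 = ∫ t, ‖f t‖ ^ 2 ∂(AddCircle.haarAddCircle : Measure UnitAddCircle) := by
  have h := inner_self_eq_norm_sq_to_K (𝕜 := ℂ) f
  rw [L2.inner_def] at h
  simp_rw [inner_self_eq_norm_sq_to_K] at h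
  have h2 : ∫ t, ((‖f t‖ : ℂ)) ^ 2 ∂(AddCircle.haarAddCircle : Measure UnitAddCircle) =
      ((∫ t, ‖f t‖ ^ 2 ∂(AddCircle.haarAddCircle : Measure UnitAddCircle) : ℝ) : ℂ) := by
    rw [← integral_complex_ofReal]
    push_cast
    rfl
  rw [← Complex.ofReal_inj, ← h2]
  exact (Complex.ofReal_pow _ _).trans h.symm

lemma integrable_norm_sq (f : LpT 2) :
    Integrable (fun t => ‖f t‖ ^ 2) (AddCircle.haarAddCircle : Measure UnitAddCircle) :=
  (Lp.memLp f).integrable_norm_pow (by norm_num)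

lemma norm_toeplitz_star_le (ψ : LpT ∞) (x : H2) :
    ‖toeplitz (star ψ) x‖ ≤ ‖mulOp ψ (x : LpT 2)‖ := by
  refine ((hardy 2).norm_orthogonalProjectionOnto_apply_le _).trans (le_of_eq ?_)
  rw [Lp.norm_def, Lp.norm_def]
  congr 1
  refine eLpNorm_congr_norm_ae ?_
  filter_upwards [Lp.coeFn_star ψ, mulOp_coe ψ x, mulOp_coe (star ψ) x] with t h1 h2 h3
  change ‖mulOp (star ψ) x t‖ = _
  rw [h2, h3, h1, Pi.star_apply, norm_mul, norm_star, norm_mul]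

lemma norm_mulOp_sq_add_le {φ ψ : LpT ∞}
    (h : ∀ᵐ t ∂(AddCircle.haarAddCircle : Measure UnitAddCircle), ‖φ t‖ ^ 2 + ‖ψ t‖ ^ 2 ≤ 1)
    (x : LpT 2) : ‖mulOp φ x‖ ^ 2 + ‖mulOp ψ x‖ ^ 2 ≤ ‖x‖ ^ 2 := by
  rw [norm_sq_eq_integral, norm_sq_eq_integral, norm_sq_eq_integral,
    ← integral_add (integrable_norm_sq _) (integrable_norm_sq _)]
  refine integral_mono_ae ((integrable_norm_sq _).add (integrable_norm_sq _))
    (integrable_norm_sq _) ?_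
  filter_upwards [h, mulOp_coe φ x, mulOp_coe ψ x] with t h1 h2 h3
  rw [h2, h3, norm_mul, norm_mul]
  nlinarith [sq_nonneg ‖x t‖]

lemma norm_sq_sub_mulOp_le {ψ : LpT ∞} {x : LpT 2}
    (h : ∀ᵐ t ∂(AddCircle.haarAddCircle : Measure UnitAddCircle),
      (1 - ‖ψ t‖ ^ 2) * ‖x t‖ ^ 2 ≤ 1) : ‖x‖ ^ 2 - ‖mulOp ψ x‖ ^ 2 ≤ 1 := by
  rw [norm_sq_eq_integral, norm_sq_eq_integral,
    ← integral_sub (integrable_norm_sq _) (integrable_norm_sq _)]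
  have h1 : ∫ _, (1 : ℝ) ∂(AddCircle.haarAddCircle : Measure UnitAddCircle) = 1 := by simp
  refine le_trans ?_ h1.le
  refine integral_mono_ae ((integrable_norm_sq _).sub (integrable_norm_sq _))
    (integrable_const _) ?_
  filter_upwards [h, mulOp_coe ψ x] with t h1 h2
  rw [h2, norm_mul]
  linarith

/-- ‖D^{1/2} x‖² = ‖x‖² - ‖T_b̄ x‖² ≥ ‖x‖² - ‖bx‖², which is the integral of (1 - |b|²)|x|². -/
lemma norm_mulOp_le_norm_defectSqrt {b : HInf} (hb : ‖b‖ ≤ 1) {φ : LpT ∞}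
    (h : ∀ᵐ t ∂(AddCircle.haarAddCircle : Measure UnitAddCircle),
      ‖φ t‖ ^ 2 + ‖(b : LpT ∞) t‖ ^ 2 ≤ 1) (x : H2) :
    ‖mulOp φ (x : LpT 2)‖ ≤ ‖defectSqrt b x‖ := by
  refine (sq_le_sq₀ (norm_nonneg _) (norm_nonneg _)).mp ?_
  rw [norm_defectSqrt_sq b hb]
  have h1 := norm_mulOp_sq_add_le h (x : LpT 2)
  have h2 := norm_toeplitz_star_le (b : LpT ∞) x
  have h3 : ‖x‖ = ‖(x : LpT 2)‖ := rfl
  rw [h3]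
  nlinarith [norm_nonneg (toeplitz (star (b : LpT ∞)) x)]

/-- Put x = by and z = T_b̄ x. Since ⟨y, z⟩ = ‖x‖², expanding 0 ≤ ‖y - z‖² gives ‖x‖² - ‖z‖² ≤ ‖y‖²
- ‖x‖²: the left side is ‖D^{1/2} x‖², the right side the integral of (1 - |b|²)|y|². -/
lemma norm_defectSqrt_toeplitz_le {b : HInf} (hb : ‖b‖ ≤ 1) {y : H2}
    (hy : mulOp (b : LpT ∞) (y : LpT 2) ∈ hardy 2)
    (h : ∀ᵐ t ∂(AddCircle.haarAddCircle : Measure UnitAddCircle),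
      (1 - ‖(b : LpT ∞) t‖ ^ 2) * ‖(y : LpT 2) t‖ ^ 2 ≤ 1) :
    ‖defectSqrt b (toeplitz (b : LpT ∞) y)‖ ≤ 1 := by
  have h1 : ‖defectSqrt b (toeplitz (b : LpT ∞) y)‖ ^ 2 ≤ 1 := by
    rw [norm_defectSqrt_sq b hb]
    set x := toeplitz (b : LpT ∞) y with hx
    set z := toeplitz (star (b : LpT ∞)) x with hz
    have h2 : ‖x‖ = ‖mulOp (b : LpT ∞) (y : LpT 2)‖ := by
      have : ((x : H2) : LpT 2) = mulOp (b : LpT ∞) (y : LpT 2) :=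
        (hardy 2).starProjection_eq_self_iff.mpr hy
      rw [← this]; rfl
    have h3 := norm_sq_sub_mulOp_le h
    have h4 := @norm_sub_sq ℂ H2 _ _ _ y z
    have h5 : inner ℂ y z = ((‖x‖ ^ 2 : ℝ) : ℂ) := by
      rw [hz, ← inner_toeplitz]
      refine (inner_self_eq_norm_sq_to_K (𝕜 := ℂ) (E := H2) x).trans ?_
      push_cast; rfl
    rw [h5] at h4
    have h6 : RCLike.re (((‖x‖ ^ 2 : ℝ) : ℂ)) = ‖x‖ ^ 2 := Complex.ofReal_re _
    rw [h6] at h4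
    rw [← h2] at h3
    have h7 : ‖y‖ = ‖(y : LpT 2)‖ := rfl
    rw [← h7] at h3
    nlinarith [sq_nonneg ‖y - z‖]
  nlinarith [norm_nonneg (defectSqrt b (toeplitz (b : LpT ∞) y))]

/-! ### Squared moduli on the circle as real parts of disc algebra functions. -/

section PowerSums

variable {ι : Type*} {d : ι → ℝ} (m : ι → ℕ)

lemma norm_coe_mul_pow_le (i : ι) {z : ℂ} (hz : ‖z‖ ≤ 1) : ‖(d i : ℂ) * z ^ m i‖ ≤ |d i| := by
  rw [norm_mul, norm_pow, Complex.norm_real, Real.norm_eq_abs]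
  exact mul_le_of_le_one_right (abs_nonneg _) (pow_le_one₀ (norm_nonneg _) hz)

lemma summable_coe_mul_pow (hd : Summable fun i => |d i|) {z : ℂ} (hz : ‖z‖ ≤ 1) :
    Summable fun i => (d i : ℂ) * z ^ m i :=
  Summable.of_norm_bounded hd fun i => norm_coe_mul_pow_le m i hz

lemma diffContOnCl_tsum (hd : Summable fun i => |d i|) :
    DiffContOnCl ℂ (fun z : ℂ => ∑' i, (d i : ℂ) * z ^ m i) (Metric.ball 0 1) := by
  constructor
  · refine Complex.differentiableOn_tsum_of_summable_norm hd (fun i => ?_) Metric.isOpen_ball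
      fun i w hw => norm_coe_mul_pow_le m i ?_
    · fun_prop
    · simpa using (mem_ball_zero_iff.mp hw).le
  · rw [closure_ball _ one_ne_zero]
    refine continuousOn_tsum (fun i => ?_) hd fun i w hw => norm_coe_mul_pow_le m i ?_
    · fun_prop
    · simpa using hw

lemma norm_tsum_coe_mul_pow_le (hd : Summable fun i => |d i|) {z : ℂ} (hz : ‖z‖ ≤ 1) :
    ‖∑' i, (d i : ℂ) * z ^ m i‖ ≤ ∑' i, |d i| :=
  tsum_of_norm_bounded hd.hasSum fun i => norm_coe_mul_pow_le m i hz

end PowerSums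

lemma re_pow_dist {z : ℂ} (hz : ‖z‖ = 1) (j k : ℕ) :
    (z ^ Nat.dist j k).re = (z ^ j * conj z ^ k).re := by
  have h1 : z * conj z = 1 := by
    rw [Complex.mul_conj, Complex.normSq_eq_norm_sq, hz]; simp
  rcases le_total k j with h | h
  · obtain ⟨l, rfl⟩ := Nat.exists_eq_add_of_le h
    rw [Nat.dist_eq_sub_of_le_right h, Nat.add_sub_cancel_left, add_comm, pow_add, mul_assoc,
      ← mul_pow, h1, one_pow, mul_one]
  · obtain ⟨l, rfl⟩ := Nat.exists_eq_add_of_le h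
    rw [Nat.dist_eq_sub_of_le h, Nat.add_sub_cancel_left, pow_add, ← mul_assoc,
      ← mul_pow, h1, one_pow, one_mul, ← map_pow, Complex.conj_re]

/-- The modulus squared on the circle of a power series with real summable coefficients is the
real part of a disc algebra function with real coefficients. -/
lemma exists_re_eq_norm_sq {c : ℕ → ℝ} (hc : Summable fun n => |c n|) :
    ∃ (q : ℂ → ℂ) (Q : ℝ), DiffContOnCl ℂ q (Metric.ball 0 1) ∧ (∀ z, ‖z‖ ≤ 1 → ‖q z‖ ≤ Q) ∧
      (∀ x : ℝ, (q x).im = 0) ∧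
      ∀ z, ‖z‖ = 1 → (q z).re = ‖∑' n, (c n : ℂ) * z ^ n‖ ^ 2 := by
  -- Expand the squared modulus as a double sum of c_j c_k z^j z̄^k. On the circle, replacing z^j
  -- z̄^k by z^|j-k| keeps the real part and makes the sum analytic.
  set d : ℕ × ℕ → ℝ := fun p => c p.1 * c p.2
  have hd : Summable fun p => |d p| := by
    simp only [d, abs_mul]
    exact hc.mul_of_nonneg hc (fun _ => abs_nonneg _) (fun _ => abs_nonneg _)
  set m : ℕ × ℕ → ℕ := fun p => Nat.dist p.1 p.2
  refine ⟨fun z => ∑' p, (d p : ℂ) * z ^ m p, ∑' p, |d p|, diffContOnCl_tsum m hd,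
    fun z hz => norm_tsum_coe_mul_pow_le m hd hz, fun x => ?_, fun z hz => ?_⟩
  · have : ∀ p, (d p : ℂ) * (x : ℂ) ^ m p = ((d p * x ^ m p : ℝ) : ℂ) := fun p => by push_cast; rfl
    simp_rw [this]
    rw [← Complex.ofReal_tsum, Complex.ofReal_im]
  · have hz' : ‖conj z‖ ≤ 1 := by simp [hz]
    have h1 := summable_coe_mul_pow (fun n => n) hc hz.le
    have h2 := summable_coe_mul_pow (fun n => n) hc hz'
    have h3 := tsum_mul_tsum_of_summable_norm h1.norm h2.norm
    have h4 : ∑' n, (c n : ℂ) * conj z ^ n = conj (∑' n, (c n : ℂ) * z ^ n) := by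
      rw [Complex.conj_tsum]
      simp
    rw [h4, Complex.mul_conj, Complex.normSq_eq_norm_sq] at h3
    rw [Complex.re_tsum (summable_coe_mul_pow m hd hz.le), ← Complex.ofReal_re (‖_‖ ^ 2), h3,
      Complex.re_tsum (summable_mul_of_summable_norm h1.norm h2.norm)]
    refine tsum_congr fun p => ?_
    have e : (c p.1 : ℂ) * z ^ p.1 * ((c p.2 : ℂ) * conj z ^ p.2) =
        (d p : ℂ) * (z ^ p.1 * conj z ^ p.2) := by simp only [d]; push_cast; ring
    rw [e, Complex.re_ofReal_mul, Complex.re_ofReal_mul, re_pow_dist hz]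

/-! ### Absolutely summable real Taylor coefficients. -/

section Taylor

variable {a : ℂ → ℂ} {K : ℝ} (ha : DifferentiableOn ℂ a {z | z.re < 1})
  (hK : ∀ z : ℂ, z.re < 1 → ‖a z‖ ≤ K * ‖1 - z‖ ^ 4)

include ha hK in
-- Cauchy's estimate on the disc of radius R = |1 - z|²/2 about z. It stays in Re < 1 because |1 -
-- z|² < 2(1 - Re z) when |z| < 1, and |1 - w| ≤ 2|1 - z| on its boundary. The fourth power in the
-- hypothesis is exactly what cancels R².
lemma norm_iteratedDeriv_two_le {z : ℂ} (hz : ‖z‖ < 1) : ‖iteratedDeriv 2 a z‖ ≤ 128 * K := by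
  have h1 : ‖1 - z‖ ^ 2 < 2 * (1 - z.re) := by
    have h2 : ‖z‖ ^ 2 < 1 := by nlinarith [norm_nonneg z]
    rw [← Complex.normSq_eq_norm_sq, Complex.normSq_apply] at h2 ⊢
    simp only [Complex.sub_re, Complex.one_re, Complex.sub_im, Complex.one_im]
    nlinarith
  have h0 : 0 < ‖1 - z‖ := by
    rw [norm_pos_iff, sub_ne_zero]
    rintro rfl
    simp at hz
  have h2 : ‖1 - z‖ ≤ 2 := (norm_sub_le _ _).trans (by rw [norm_one]; linarith)
  set R := ‖1 - z‖ ^ 2 / 2 with hR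
  have hR0 : 0 < R := by positivity
  have hsub : Metric.closedBall z R ⊆ {z : ℂ | z.re < 1} := by
    intro w hw
    rw [mem_closedBall_iff_norm] at hw
    have := (Complex.re_le_norm (w - z)).trans hw
    rw [Complex.sub_re] at this
    change w.re < 1
    linarith
  have h3 := Complex.norm_iteratedDeriv_le_of_forall_mem_sphere_norm_le (c := z) (R := R)
    (C := K * (2 * ‖1 - z‖) ^ 4) (f := a) 2 hR0
    (DifferentiableOn.diffContOnCl (ha.mono (Metric.closure_ball_subset_closedBall.trans hsub)))
    (fun w hw => by
      have hw1 := hsub (Metric.sphere_subset_closedBall hw)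
      have hK0 : 0 ≤ K := by
        have := (norm_nonneg _).trans (hK 0 (by simp))
        simpa using this
      refine (hK w hw1).trans ?_
      have h5 : ‖1 - w‖ ≤ 2 * ‖1 - z‖ := by
        have h6 : ‖w - z‖ = R := mem_sphere_iff_norm.mp hw
        have h7 : 1 - w = (1 - z) - (w - z) := by ring
        rw [h7]
        refine (norm_sub_le _ _).trans ?_
        rw [h6]
        nlinarith
      gcongr)
  refine h3.trans (le_of_eq ?_)
  rw [hR, div_pow, ← pow_mul]
  simp only [Nat.factorial]
  field_simp
  push_cast
  ring

include ha hK in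
-- Cauchy's estimate for the bounded function a'' on circles of radius ρ → 1. Hence the Taylor
-- coefficients of a are O(n⁻²).
lemma norm_iteratedDeriv_add_two_le (n : ℕ) :
    ‖iteratedDeriv (n + 2) a 0‖ ≤ n.factorial * (128 * K) := by
  have hb : Metric.ball (0 : ℂ) 1 ⊆ {z : ℂ | z.re < 1} := fun z hz =>
    (Complex.re_le_norm z).trans_lt (mem_ball_zero_iff.mp hz)
  have hd : DifferentiableOn ℂ (iteratedDeriv 2 a) (Metric.ball 0 1) := by
    rw [iteratedDeriv_succ, iteratedDeriv_one]
    exact ((ha.mono hb).deriv Metric.isOpen_ball).deriv Metric.isOpen_ball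
  have e : iteratedDeriv (n + 2) a = iteratedDeriv n (iteratedDeriv 2 a) := by
    simp only [iteratedDeriv_eq_iterate, Function.iterate_add_apply]
  have h1 : ∀ ρ ∈ Ioo (0 : ℝ) 1,
      ‖iteratedDeriv (n + 2) a 0‖ * ρ ^ n ≤ n.factorial * (128 * K) := by
    intro ρ hρ
    rw [e, ← le_div_iff₀ (pow_pos hρ.1 n)]
    refine Complex.norm_iteratedDeriv_le_of_forall_mem_sphere_norm_le n hρ.1
      (DifferentiableOn.diffContOnCl (hd.mono ?_)) fun w hw => ?_
    · refine Metric.closure_ball_subset_closedBall.trans ?_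
      exact Metric.closedBall_subset_ball hρ.2
    · refine norm_iteratedDeriv_two_le ha hK ?_
      rw [mem_sphere_zero_iff_norm.mp hw]
      exact hρ.2
  have h2 : Tendsto (fun ρ : ℝ => ‖iteratedDeriv (n + 2) a 0‖ * ρ ^ n) (𝓝[<] 1)
      (𝓝 (‖iteratedDeriv (n + 2) a 0‖ * 1 ^ n)) :=
    (Continuous.tendsto (by fun_prop) 1).mono_left nhdsWithin_le_nhds
  rw [one_pow, mul_one] at h2
  refine le_of_tendsto h2 ?_
  filter_upwards [Ioo_mem_nhdsLT (zero_lt_one' ℝ)] with ρ hρ using h1 ρ hρ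

include ha hK in
lemma exists_real_taylor (hconj : ∀ z : ℂ, z.re < 1 → a (conj z) = conj (a z)) :
    ∃ c : ℕ → ℝ, (Summable fun n => |c n|) ∧
      ∀ z : ℂ, ‖z‖ < 1 → ∑' n, (c n : ℂ) * z ^ n = a z := by
  have hb : Metric.ball (0 : ℂ) 1 ⊆ {z : ℂ | z.re < 1} := fun z hz =>
    (Complex.re_le_norm z).trans_lt (mem_ball_zero_iff.mp hz)
  set α : ℕ → ℂ := fun n => (n.factorial : ℂ)⁻¹ * iteratedDeriv n a 0
  have hsum : ∀ z : ℂ, ‖z‖ < 1 → HasSum (fun n => α n * z ^ n) (a z) := by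
    intro z hz
    have := Complex.hasSum_taylorSeries_on_ball (c := 0) (ha.mono hb) (mem_ball_zero_iff.mpr hz)
    simp only [sub_zero, smul_eq_mul] at this
    refine this.congr_fun fun n => ?_
    simp only [α]; ring
  have hα : ∀ n, ‖α (n + 2)‖ ≤ 128 * K * (1 / ((n + 1 : ℕ) : ℝ) ^ 2) := by
    intro n
    have hK0 : 0 ≤ K := by
      have := (norm_nonneg _).trans (hK 0 (by simp))
      simpa using this
    have hn : (0 : ℝ) < n.factorial := by positivity
    simp only [α]
    rw [norm_mul, norm_inv, Complex.norm_natCast, Nat.factorial_succ, Nat.factorial_succ]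
    push_cast
    calc _ ≤ (((n : ℝ) + 1 + 1) * (((n : ℝ) + 1) * n.factorial))⁻¹ *
        (n.factorial * (128 * K)) := by
          gcongr
          exact norm_iteratedDeriv_add_two_le ha hK n
      _ = 128 * K * (1 / (((n : ℝ) + 1 + 1) * ((n : ℝ) + 1))) := by field_simp
      _ ≤ _ := by
          rw [sq]
          gcongr
          linarith
  have hs : Summable fun n => ‖α n‖ := by
    rw [← summable_nat_add_iff 2]
    refine Summable.of_nonneg_of_le (fun _ => norm_nonneg _) hα (Summable.mul_left _ ?_)
    exact (summable_nat_add_iff (f := fun n : ℕ => 1 / (n : ℝ) ^ 2) 1).mpr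
      (Real.summable_one_div_nat_pow.mpr one_lt_two)
  -- Averaging the series of a(z) with the conjugate of that of a(z̄) replaces each coefficient by
  -- its real part.
  refine ⟨fun n => (α n).re, hs.of_nonneg_of_le (fun _ => abs_nonneg _)
    fun n => Complex.abs_re_le_norm _, fun z hz => ?_⟩
  have h1 := hsum z hz
  have h2 := (Complex.hasSum_conj'.mpr (hsum (conj z) (by simpa using hz)))
  rw [hconj z (hb (mem_ball_zero_iff.mpr hz)), Complex.conj_conj] at h2
  have h3 := ((h1.add h2).mul_left (2⁻¹ : ℂ))
  have e : (2⁻¹ : ℂ) * (a z + a z) = a z := by ring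
  rw [e] at h3
  refine (h3.congr_fun fun n => ?_).tsum_eq
  rw [Complex.re_eq_add_conj, map_mul _ (α n), map_pow, Complex.conj_conj]
  ring

end Taylor

/-! ### The function A and its disc algebra properties. -/

section Herglotz

variable (δ : ℕ → ℝ)

/-- The function `∑ 2⁻ⁿ / (1 + δₙ - z)`. -/
def herg (z : ℂ) : ℂ := ∑' n, (2⁻¹ : ℂ) ^ n * (1 + δ n - z)⁻¹

variable {δ} (hδ : ∀ n, 0 ≤ δ n)

include hδ in
lemma norm_herg_term_le (n : ℕ) {z : ℂ} {η : ℝ} (hη : 0 < η) (hz : z.re ≤ 1 - η) :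
    ‖(2⁻¹ : ℂ) ^ n * (1 + δ n - z)⁻¹‖ ≤ (2⁻¹ : ℝ) ^ n * η⁻¹ := by
  have h : η ≤ ‖1 + (δ n : ℂ) - z‖ := by
    refine le_trans ?_ (Complex.re_le_norm _)
    simp only [Complex.sub_re, Complex.add_re, Complex.one_re, Complex.ofReal_re]
    linarith [hδ n]
  rw [norm_mul, norm_pow, norm_inv, norm_inv, Complex.norm_ofNat]
  gcongr

lemma summable_two_inv_pow_mul (x : ℝ) : Summable fun n : ℕ => (2⁻¹ : ℝ) ^ n * x :=
  (summable_geometric_of_lt_one (by norm_num) (by norm_num)).mul_right _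

include hδ in
lemma herg_term_re_nonneg (n : ℕ) {z : ℂ} (hz : z.re < 1) :
    0 ≤ ((2⁻¹ : ℂ) ^ n * (1 + δ n - z)⁻¹).re := by
  have e : (2⁻¹ : ℂ) ^ n * (1 + δ n - z)⁻¹ = (((2⁻¹ : ℝ) ^ n : ℝ) : ℂ) * (1 + δ n - z)⁻¹ := by
    push_cast; rfl
  rw [e, Complex.re_ofReal_mul, Complex.inv_re]
  refine mul_nonneg (by positivity) (div_nonneg ?_ (Complex.normSq_nonneg _))
  simp only [Complex.sub_re, Complex.add_re, Complex.one_re, Complex.ofReal_re]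
  linarith [hδ n]

include hδ in
lemma summable_herg {z : ℂ} (hz : z.re < 1) :
    Summable fun n => (2⁻¹ : ℂ) ^ n * (1 + δ n - z)⁻¹ :=
  Summable.of_norm_bounded (summable_two_inv_pow_mul (1 - z.re)⁻¹) fun n =>
    norm_herg_term_le hδ n (by linarith) (by linarith)

include hδ in
-- All terms have nonnegative real part, so the sum dominates each one; hence exp(-h) absorbs every
-- test exponential simultaneously.
lemma herg_term_re_le (n : ℕ) {z : ℂ} (hz : z.re < 1) :
    ((2⁻¹ : ℂ) ^ n * (1 + δ n - z)⁻¹).re ≤ (herg δ z).re := by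
  rw [herg, Complex.re_tsum (summable_herg hδ hz)]
  exact ((Complex.hasSum_re (summable_herg hδ hz).hasSum).summable).le_tsum n
    fun k _ => herg_term_re_nonneg hδ k hz

lemma herg_conj (z : ℂ) : herg δ (conj z) = conj (herg δ z) := by
  rw [herg, herg, Complex.conj_tsum]
  refine tsum_congr fun n => ?_
  simp [map_inv₀, Complex.conj_ofNat]

include hδ in
lemma differentiableOn_herg : DifferentiableOn ℂ (herg δ) {z | z.re < 1} := by
  intro z hz
  have hz' : z.re < 1 := hz
  set η := (1 - z.re) / 2 with hη
  have h0 : 0 < η := by rw [hη]; linarith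
  have ho : IsOpen {w : ℂ | w.re < 1 - η} := isOpen_lt Complex.continuous_re continuous_const
  have h1 : DifferentiableOn ℂ (herg δ) {w : ℂ | w.re < 1 - η} := by
    refine Complex.differentiableOn_tsum_of_summable_norm (summable_two_inv_pow_mul η⁻¹)
      (fun n w hw => ?_) ho fun n w hw => norm_herg_term_le hδ n h0 (le_of_lt hw)
    have hw' : w.re < 1 - η := hw
    refine DifferentiableAt.differentiableWithinAt ?_
    refine DifferentiableAt.const_mul (DifferentiableAt.inv (by fun_prop) fun h => ?_) _
    have := congrArg Complex.re h
    simp only [Complex.sub_re, Complex.add_re, Complex.one_re, Complex.ofReal_re,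
      Complex.zero_re] at this
    linarith [hδ n]
  exact (h1.differentiableAt (ho.mem_nhds (by change z.re < 1 - η; linarith))).differentiableWithinAt

/-- `(1 - z)⁴ exp (-h) / 32` for `h = herg δ`. -/
def mate (δ : ℕ → ℝ) (z : ℂ) : ℂ := 32⁻¹ * (1 - z) ^ 4 * Complex.exp (-herg δ z)

include hδ in
lemma norm_mate_mul_exp_le (n : ℕ) {z : ℂ} (hz : z.re < 1) :
    ‖mate δ z * Complex.exp ((2⁻¹ : ℂ) ^ n * (1 + δ n - z)⁻¹)‖ ≤ 32⁻¹ * ‖1 - z‖ ^ 4 := by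
  rw [mate, mul_assoc, ← Complex.exp_add, norm_mul, norm_mul, norm_inv, norm_pow,
    Complex.norm_ofNat, Complex.norm_exp]
  refine mul_le_of_le_one_right (by positivity) (Real.exp_le_one_iff.mpr ?_)
  rw [Complex.add_re, Complex.neg_re]
  linarith [herg_term_re_le hδ n hz]

include hδ in
lemma norm_mate_le {z : ℂ} (hz : z.re < 1) : ‖mate δ z‖ ≤ 32⁻¹ * ‖1 - z‖ ^ 4 := by
  rw [mate, norm_mul, norm_mul, norm_inv, norm_pow, Complex.norm_ofNat, Complex.norm_exp]
  refine mul_le_of_le_one_right (by positivity) (Real.exp_le_one_iff.mpr ?_)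
  rw [Complex.neg_re]
  linarith [herg_term_re_le hδ 0 hz, herg_term_re_nonneg hδ 0 hz]

lemma mate_ne_zero {z : ℂ} (hz : z ≠ 1) : mate δ z ≠ 0 :=
  mul_ne_zero (mul_ne_zero (by norm_num) (pow_ne_zero _ (sub_ne_zero.mpr hz.symm)))
    (Complex.exp_ne_zero _)

include hδ in
lemma differentiableOn_mate : DifferentiableOn ℂ (mate δ) {z | z.re < 1} := by
  have := (differentiableOn_herg hδ).neg.cexp
  exact DifferentiableOn.mul (by fun_prop) this

lemma mate_conj (z : ℂ) : mate δ (conj z) = conj (mate δ z) := by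
  simp only [mate, herg_conj, map_mul, map_pow, map_sub, map_one, map_inv₀, ← Complex.exp_conj,
    map_neg, Complex.conj_ofNat]

end Herglotz

/-- The power series A is identified with `mate` only in the open disc; bounds on the circle follow
by continuity. -/
lemma norm_le_of_forall_ball {F : ℂ → ℂ} (hF : DiffContOnCl ℂ F (Metric.ball 0 1)) {M : ℝ}
    (h : ∀ z, ‖z‖ < 1 → ‖F z‖ ≤ M) {z : ℂ} (hz : ‖z‖ ≤ 1) : ‖F z‖ ≤ M := by
  have hz' : z ∈ closure (Metric.ball (0 : ℂ) 1) := by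
    rw [closure_ball _ one_ne_zero]; simpa using hz
  have h1 := hF.2 z hz'
  have := mem_closure_iff_nhdsWithin_neBot.mp hz'
  refine le_of_tendsto ((h1.mono subset_closure).norm) ?_
  filter_upwards [self_mem_nhdsWithin] with w hw
  exact h w (mem_ball_zero_iff.mp hw)

/-- A disc algebra function `A`, small on the circle near `1` but without zeros in the disc,
whose modulus squared on the circle is `Re q`. -/
lemma exists_mate {δ : ℕ → ℝ} (hδ : ∀ n, 0 < δ n) :
    ∃ (A q : ℂ → ℂ) (Q : ℝ), DiffContOnCl ℂ A (Metric.ball 0 1) ∧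
      DiffContOnCl ℂ q (Metric.ball 0 1) ∧ (∀ z, ‖z‖ ≤ 1 → ‖q z‖ ≤ Q) ∧
      (∀ x : ℝ, (q x).im = 0) ∧ (∀ z, ‖z‖ = 1 → (q z).re = ‖A z‖ ^ 2) ∧
      (∀ z, ‖z‖ < 1 → A z ≠ 0) ∧ (∀ z, ‖z‖ ≤ 1 → ‖A z‖ ≤ 2⁻¹) ∧
      (∀ n, DiffContOnCl ℂ (fun z : ℂ => Complex.exp ((2⁻¹ : ℂ) ^ n * (1 + δ n - z)⁻¹))
        (Metric.ball 0 1)) ∧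
      ∀ n (z : ℂ), ‖z‖ ≤ 1 → ‖A z * Complex.exp ((2⁻¹ : ℂ) ^ n * (1 + δ n - z)⁻¹)‖ ≤ 2⁻¹ := by
  have hδ' : ∀ n, 0 ≤ δ n := fun n => (hδ n).le
  obtain ⟨c, hc, hcA⟩ := exists_real_taylor (differentiableOn_mate hδ')
    (fun z hz => norm_mate_le hδ' hz) fun z _ => mate_conj z
  obtain ⟨q, Q, hq, hQ, him, hre⟩ := exists_re_eq_norm_sq hc
  have hA : DiffContOnCl ℂ (fun z : ℂ => ∑' n, (c n : ℂ) * z ^ n) (Metric.ball 0 1) :=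
    diffContOnCl_tsum (fun n => n) hc
  have hre1 : ∀ z : ℂ, ‖z‖ < 1 → z.re < 1 := fun z hz => (Complex.re_le_norm z).trans_lt hz
  have h16 : ∀ z : ℂ, ‖z‖ < 1 → 32⁻¹ * ‖1 - z‖ ^ 4 ≤ 2⁻¹ := by
    intro z hz
    have : ‖1 - z‖ ≤ 2 := (norm_sub_le _ _).trans (by rw [norm_one]; linarith)
    calc 32⁻¹ * ‖1 - z‖ ^ 4 ≤ 32⁻¹ * 2 ^ 4 := by gcongr
      _ = 2⁻¹ := by norm_num
  have hy : ∀ n, DiffContOnCl ℂ (fun z : ℂ => Complex.exp ((2⁻¹ : ℂ) ^ n * (1 + δ n - z)⁻¹))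
        (Metric.ball 0 1) := by
    intro n
    refine DifferentiableOn.diffContOnCl fun z hz => ?_
    rw [closure_ball _ one_ne_zero, mem_closedBall_zero_iff] at hz
    refine (DifferentiableAt.cexp (DifferentiableAt.const_mul
      (DifferentiableAt.inv (by fun_prop) fun h => ?_) _)).differentiableWithinAt
    have h1 := congrArg Complex.re h
    simp only [Complex.sub_re, Complex.add_re, Complex.one_re, Complex.ofReal_re,
      Complex.zero_re] at h1
    linarith [hδ n, Complex.re_le_norm z]
  refine ⟨_, q, Q, hA, hq, hQ, him, hre, fun z hz => ?_, fun z hz => ?_, hy, fun n z hz => ?_⟩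
  · rw [hcA z hz]
    refine mate_ne_zero ?_
    rintro rfl
    simp at hz
  · refine norm_le_of_forall_ball hA (fun w hw => ?_) hz
    rw [hcA w hw]
    exact (norm_mate_le hδ' (hre1 w hw)).trans (h16 w hw)
  · refine norm_le_of_forall_ball (diffContOnCl_mul hA (hy n)) (fun w hw => ?_) hz
    rw [hcA w hw]
    exact (norm_mate_mul_exp_le hδ' n (hre1 w hw)).trans (h16 w hw)

/-! ### Blaschke products with real zeros. -/

/-- The Blaschke factor with a real zero `w`. -/
def blaschkeFactor (w : ℝ) (z : ℂ) : ℂ := (w - z) * (1 - w * z)⁻¹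

section Factor

variable {w : ℝ} (h0 : 0 ≤ w) (h1 : w < 1) {z : ℂ}

include h0 h1 in
lemma norm_coe_lt_one : ‖(w : ℂ)‖ < 1 := by
  rw [Complex.norm_real, Real.norm_of_nonneg h0]; exact h1

lemma norm_one_sub_mul_sq (w : ℝ) (z : ℂ) :
    ‖1 - w * z‖ ^ 2 = ‖w - z‖ ^ 2 + (1 - w ^ 2) * (1 - ‖z‖ ^ 2) := by
  simp only [← Complex.normSq_eq_norm_sq, Complex.normSq_apply]
  simp
  ring

include h0 h1 in
lemma norm_blaschkeFactor_le (hz : ‖z‖ ≤ 1) : ‖blaschkeFactor w z‖ ≤ 1 := by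
  have h := one_sub_mul_ne_zero (norm_coe_lt_one h0 h1) hz
  rw [blaschkeFactor, norm_mul, norm_inv, ← div_eq_mul_inv,
    div_le_one (norm_pos_iff.mpr h)]
  refine (sq_le_sq₀ (norm_nonneg _) (norm_nonneg _)).mp ?_
  rw [norm_one_sub_mul_sq]
  have : 0 ≤ (1 - w ^ 2) * (1 - ‖z‖ ^ 2) :=
    mul_nonneg (by nlinarith) (by nlinarith [norm_nonneg z])
  linarith

include h0 h1 in
lemma norm_blaschkeFactor_eq (hz : ‖z‖ = 1) : ‖blaschkeFactor w z‖ = 1 := by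
  have h := one_sub_mul_ne_zero (norm_coe_lt_one h0 h1) hz.le
  rw [blaschkeFactor, norm_mul, norm_inv, ← div_eq_mul_inv,
    div_eq_one_iff_eq (norm_ne_zero_iff.mpr h)]
  refine (sq_eq_sq₀ (norm_nonneg _) (norm_nonneg _)).mp ?_
  rw [norm_one_sub_mul_sq, hz]
  ring

include h0 h1 in
lemma diffContOnCl_blaschkeFactor :
    DiffContOnCl ℂ (blaschkeFactor w) (Metric.ball 0 1) := by
  refine diffContOnCl_mul (Differentiable.diffContOnCl (by fun_prop)) ?_
  exact diffContOnCl_kernel (norm_coe_lt_one h0 h1)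

include h0 h1 in
-- The sign w - z makes the factor tend to 1 as w → 1: its difference from 1 is (w - 1)(1 + z)/(1 -
-- wz), and |1 - z| ≤ 2|1 - wz|. So the product converges on the closed disc except at 1, which
-- includes almost every boundary point.
lemma norm_blaschkeFactor_sub_one_le (hz : ‖z‖ ≤ 1) (hz1 : z ≠ 1) :
    ‖blaschkeFactor w z - 1‖ ≤ (1 - w) * (4 / ‖1 - z‖) := by
  have h := one_sub_mul_ne_zero (norm_coe_lt_one h0 h1) hz
  have hp : 0 < ‖1 - (w : ℂ) * z‖ := norm_pos_iff.mpr h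
  have hq : 0 < ‖1 - z‖ := norm_pos_iff.mpr (sub_ne_zero.mpr hz1.symm)
  have e : blaschkeFactor w z - 1 = ((w - 1 : ℝ) : ℂ) * (1 + z) * (1 - w * z)⁻¹ := by
    rw [blaschkeFactor]
    push_cast
    field_simp
    ring
  have e2 : 1 - z = (1 - w * z) + ((w - 1 : ℝ) : ℂ) * z := by push_cast; ring
  have hw : ‖((w - 1 : ℝ) : ℂ)‖ = 1 - w := by
    rw [Complex.norm_real, Real.norm_of_nonpos (by linarith)]; ring
  have h3 : 1 - w ≤ ‖1 - (w : ℂ) * z‖ := by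
    have := norm_sub_norm_le (1 : ℂ) (w * z)
    rw [norm_one, norm_mul, Complex.norm_real, Real.norm_of_nonneg h0] at this
    nlinarith
  have h4 : ‖1 - z‖ ≤ 2 * ‖1 - (w : ℂ) * z‖ := by
    rw [e2]
    refine (norm_add_le _ _).trans ?_
    rw [norm_mul, hw]
    nlinarith
  have h5 : ‖1 + z‖ ≤ 2 := (norm_add_le _ _).trans (by rw [norm_one]; linarith)
  rw [e, norm_mul, norm_mul, norm_inv, hw, mul_assoc]
  refine mul_le_mul_of_nonneg_left ?_ (by linarith)
  rw [← div_eq_mul_inv, div_le_div_iff₀ hp hq]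
  nlinarith [norm_nonneg (1 + z)]

lemma blaschkeFactor_ofReal (w x : ℝ) :
    blaschkeFactor w x = (((w - x) * (1 - w * x)⁻¹ : ℝ) : ℂ) := by
  rw [blaschkeFactor]; push_cast; rfl

end Factor

/-- The Blaschke product with real zeros `w n`. -/
def blaschke (w : ℕ → ℝ) (z : ℂ) : ℂ := ∏' n, blaschkeFactor (w n) z

section Product

variable {w : ℕ → ℝ} (h0 : ∀ n, 0 ≤ w n) (h1 : ∀ n, w n < 1) (hs : Summable fun n => 1 - w n)
  {z : ℂ} (hz : ‖z‖ ≤ 1) (hz1 : z ≠ 1)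

include h0 h1 hs hz hz1 in
lemma tendsto_blaschke :
    Tendsto (fun N => ∏ n ∈ Finset.range N, blaschkeFactor (w n) z) atTop
      (𝓝 (blaschke w z)) := by
  have h : Summable fun n => ‖blaschkeFactor (w n) z - 1‖ :=
    Summable.of_nonneg_of_le (fun _ => norm_nonneg _)
      (fun n => norm_blaschkeFactor_sub_one_le (h0 n) (h1 n) hz hz1) (hs.mul_right _)
  have h2 := (multipliable_one_add_of_summable h).hasProd.tendsto_prod_nat
  simpa only [add_sub_cancel, blaschke] using h2

include h0 h1 hs hz1 in
lemma norm_blaschke_eq_one (hz' : ‖z‖ = 1) : ‖blaschke w z‖ = 1 := by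
  have h := (tendsto_blaschke h0 h1 hs hz'.le hz1).norm
  simp_rw [norm_prod, fun n => norm_blaschkeFactor_eq (h0 n) (h1 n) hz', Finset.prod_const_one] at h
  exact tendsto_nhds_unique h tendsto_const_nhds

include h0 h1 hs in
lemma blaschke_im {x : ℝ} (hx : |x| < 1) : (blaschke w x).im = 0 := by
  have hx1 : (x : ℂ) ≠ 1 := by
    intro h
    have : x = 1 := by exact_mod_cast h
    rw [this, abs_one] at hx
    exact lt_irrefl _ hx
  have h := tendsto_blaschke h0 h1 hs (z := x) (by simpa using hx.le) hx1
  have h2 := (Complex.continuous_im.tendsto _).comp h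
  refine tendsto_nhds_unique h2 (tendsto_const_nhds.congr fun N => ?_)
  simp only [Function.comp_apply, blaschkeFactor_ofReal]
  rw [← Complex.ofReal_prod, Complex.ofReal_im]

lemma blaschke_zero (n : ℕ) : blaschke w (w n) = 0 :=
  tprod_of_exists_eq_zero ⟨n, by simp [blaschkeFactor]⟩

include h0 h1 hs in
/-- The square of a Blaschke product times the exponential of a disc algebra function. -/
lemma bddLim_blaschke_sq_mul {g : ℂ → ℂ} (hg : DiffContOnCl ℂ g (Metric.ball 0 1)) :
    BddLim fun z => blaschke w z ^ 2 * g z := by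
  have hB : BddLim fun z => blaschke w z ^ 2 := by
    refine ⟨1, fun N z => (∏ n ∈ Finset.range N, blaschkeFactor (w n) z) ^ 2, fun N => ?_,
      fun N z hz => ?_, fun z hz hz1 => (tendsto_blaschke h0 h1 hs hz hz1).pow 2⟩
    · have h : DiffContOnCl ℂ (fun z => ∏ n ∈ Finset.range N, blaschkeFactor (w n) z)
          (Metric.ball 0 1) :=
        ⟨DifferentiableOn.fun_finsetProd fun n _ => (diffContOnCl_blaschkeFactor (h0 n) (h1 n)).1,
          continuousOn_finsetProd _ fun n _ => (diffContOnCl_blaschkeFactor (h0 n) (h1 n)).2⟩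
      exact ⟨h.1.pow 2, h.2.pow 2⟩
    · rw [norm_pow, norm_prod]
      refine pow_le_one₀ (by positivity) (Finset.prod_le_one (fun _ _ => norm_nonneg _)
        fun n _ => norm_blaschkeFactor_le (h0 n) (h1 n) hz)
  exact hB.mul hg

end Product

/-! ### Lower bounds for the Blaschke product with zeros 1 - 8⁻ⁿ. -/

/-- (v + u)/(v - u) = 1 + 2u/(v - u) ≤ exp(2u/(v - u)), and the hypothesis turns 1/(v - u) into k/v.
With u, v the distances to 1 of a zero and a point, in either order, this bounds one Blaschke
factor. -/
lemma exp_le_sub_div_add {u v : ℝ} (hu : 0 < u) (hv : 0 < v) {k : ℝ} (hk : 0 < k)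
    (h : v ≤ k * (v - u)) : Real.exp (-(2 * k * (u / v))) ≤ (v - u) / (v + u) := by
  have h1 : 0 < v - u := by
    by_contra hc
    nlinarith
  rw [Real.exp_neg, inv_le_comm₀ (Real.exp_pos _) (by positivity), inv_div]
  refine le_trans ?_ (Real.add_one_le_exp _)
  rw [div_le_iff₀ h1]
  have h2 : u ≤ k * (u / v) * (v - u) := by
    have : k * (u / v) * (v - u) = (u / v) * (k * (v - u)) := by ring
    rw [this]
    calc u = u / v * v := by field_simp
      _ ≤ _ := by gcongr
  nlinarith

lemma abs_sub_div_add_le_norm_blaschkeFactor {d e : ℝ} (hd : 0 < d) (he : 0 < e) (he1 : e ≤ 1) : |d - e| / (d + e) ≤ ‖blaschkeFactor (1 - e) ((1 - d : ℝ) : ℂ)‖ := by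
  rw [blaschkeFactor_ofReal, Complex.norm_real, Real.norm_eq_abs, abs_mul, abs_inv,
    ← div_eq_mul_inv]
  have e1 : 1 - e - (1 - d) = d - e := by ring
  have e2 : 1 - (1 - e) * (1 - d) = d + e - e * d := by ring
  have h : 0 < d + e - e * d := by nlinarith
  rw [e1, e2, abs_of_pos h]
  gcongr
  nlinarith

lemma exp_neg_le_prod {p : ℕ → ℝ} {K : ℝ} (hK : 0 ≤ K) (N : ℕ)
    (hp : ∀ i < N, Real.exp (-(K * 8⁻¹ ^ i)) ≤ p i) :
    Real.exp (-(2 * K)) ≤ ∏ i ∈ Finset.range N, p i := by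
  refine le_trans ?_ (Finset.prod_le_prod (fun _ _ => (Real.exp_pos _).le)
    fun i hi => hp i (Finset.mem_range.mp hi))
  rw [← Real.exp_sum, Finset.sum_neg_distrib, ← Finset.mul_sum, Real.exp_le_exp]
  have h : ∑ i ∈ Finset.range N, (8⁻¹ : ℝ) ^ i ≤ 2 := by
    refine ((summable_geometric_of_lt_one (by norm_num) (by norm_num)).sum_le_tsum _
      fun _ _ => by positivity).trans ?_
    rw [tsum_geometric_of_lt_one (by norm_num) (by norm_num)]
    norm_num
  nlinarith

/-- The Blaschke product with zeros `1 - 8⁻ⁿ` is bounded below off neighbourhoods of its zeros. -/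
lemma exp_le_norm_blaschke (n : ℕ) {d : ℝ} (h1 : 3 / 64 * 8⁻¹ ^ n ≤ |d - 8⁻¹ ^ n|)
    (h2 : d ≤ 9 / 8 * 8⁻¹ ^ n) (h3 : 71 / 64 * 8⁻¹ ^ (n + 1) ≤ d) (hd1 : d < 1) :
    Real.exp (-300) ≤ ‖blaschke (fun n => 1 - 8⁻¹ ^ n) ((1 - d : ℝ) : ℂ)‖ := by
  have hd : 0 < d := lt_of_lt_of_le (by positivity) h3
  have hpos : ∀ m : ℕ, (0 : ℝ) < 8⁻¹ ^ m := fun m => by positivity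
  have hle : ∀ m : ℕ, (8⁻¹ : ℝ) ^ m ≤ 1 := fun m => pow_le_one₀ (by norm_num) (by norm_num)
  have hx1 : ((1 - d : ℝ) : ℂ) ≠ 1 := by
    intro h
    have : 1 - d = 1 := by exact_mod_cast h
    linarith
  have hlim := (tendsto_blaschke (w := fun n => 1 - 8⁻¹ ^ n) (z := ((1 - d : ℝ) : ℂ))
    (fun m => by simpa using hle m) (fun m => by simp)
    (by simpa using summable_geometric_of_lt_one (r := (8⁻¹ : ℝ)) (by norm_num) (by norm_num))
    (by rw [Complex.norm_real, Real.norm_of_nonneg (by linarith)]; linarith) hx1).norm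
  refine ge_of_tendsto hlim ?_
  filter_upwards [eventually_ge_atTop (n + 1)] with N hN
  obtain ⟨k, rfl⟩ := Nat.exists_eq_add_of_le hN
  -- Split into the zeros of index at most n and those beyond; reversing the first block makes the
  -- bounds on u/v decay like 8⁻ⁱ in both.
  rw [norm_prod, Finset.prod_range_add, ← Finset.prod_range_reflect]
  have hA : Real.exp (-(2 * 54)) ≤ ∏ j ∈ Finset.range (n + 1),
      ‖blaschkeFactor (1 - 8⁻¹ ^ (n + 1 - 1 - j)) ((1 - d : ℝ) : ℂ)‖ := by
    refine exp_neg_le_prod (by norm_num) _ fun i hi => ?_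
    rw [Nat.add_sub_cancel]
    have hi' : i ≤ n := Nat.lt_succ_iff.mp hi
    have hm : (8⁻¹ : ℝ) ^ n = 8⁻¹ ^ (n - i) * 8⁻¹ ^ i := by rw [← pow_add, Nat.sub_add_cancel hi']
    have hr : d / 8⁻¹ ^ (n - i) ≤ 9 / 8 * 8⁻¹ ^ i := by
      rw [div_le_iff₀ (hpos _)]
      rw [hm] at h2
      linarith
    refine le_trans ?_ (abs_sub_div_add_le_norm_blaschkeFactor hd (hpos _) (hle _))
    rcases Nat.eq_zero_or_pos i with rfl | hi0
    · rw [Nat.sub_zero] at hr ⊢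
      -- The nearest zero dictates k = 24: the worst case is d = 9/8 · 8⁻ⁿ with gap 3/64 · 8⁻ⁿ, and
      -- (9/8)/(3/64) = 24. The bound 54 is 2k · 9/8.
      rcases le_total d (8⁻¹ ^ n) with hdn | hdn
      · rw [abs_sub_comm, abs_of_nonneg (by linarith)] at h1 ⊢
        rw [add_comm d]
        refine le_trans ?_ (exp_le_sub_div_add hd (hpos n) (k := 24) (by norm_num) (by linarith))
        rw [Real.exp_le_exp]
        linarith
      · rw [abs_of_nonneg (by linarith)] at h1 ⊢
        refine le_trans ?_ (exp_le_sub_div_add (hpos n) hd (k := 24) (by norm_num) (by linarith))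
        rw [Real.exp_le_exp]
        have : 8⁻¹ ^ n / d ≤ 1 := (div_le_one hd).mpr hdn
        rw [pow_zero]
        linarith
    · have h8 : (8⁻¹ : ℝ) ^ i ≤ 8⁻¹ := by
        simpa using pow_le_pow_of_le_one (a := (8⁻¹ : ℝ)) (by norm_num) (by norm_num) hi0
      have hbig : 8 * (8⁻¹ : ℝ) ^ n ≤ 8⁻¹ ^ (n - i) := by
        rw [hm]
        nlinarith [hpos (n - i)]
      rw [abs_sub_comm, abs_of_nonneg (by linarith [hpos n]), add_comm d]
      refine le_trans ?_ (exp_le_sub_div_add hd (hpos _) (k := 24) (by norm_num)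
        (by linarith [hpos n]))
      rw [Real.exp_le_exp]
      linarith
  have hB : Real.exp (-(2 * 48)) ≤ ∏ j ∈ Finset.range k,
      ‖blaschkeFactor (1 - 8⁻¹ ^ (n + 1 + j)) ((1 - d : ℝ) : ℂ)‖ := by
    refine exp_neg_le_prod (by norm_num) _ fun i _ => ?_
    refine le_trans ?_ (abs_sub_div_add_le_norm_blaschkeFactor hd (hpos _) (hle _))
    have hm : (8⁻¹ : ℝ) ^ (n + 1 + i) = 8⁻¹ ^ (n + 1) * 8⁻¹ ^ i := pow_add _ _ _
    have hm1 : (8⁻¹ : ℝ) ^ (n + 1 + i) ≤ 8⁻¹ ^ (n + 1) :=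
      pow_le_pow_of_le_one (by norm_num) (by norm_num) (Nat.le_add_right _ _)
    rw [abs_of_nonneg (by linarith [hpos (n + 1)])]
    refine le_trans ?_ (exp_le_sub_div_add (hpos _) hd (k := 24) (by norm_num)
      (by linarith [hpos (n + 1)]))
    rw [Real.exp_le_exp]
    have : 8⁻¹ ^ (n + 1 + i) / d ≤ 8⁻¹ ^ i := by
      rw [div_le_iff₀ hd, hm, mul_comm]
      gcongr
      linarith [hpos (n + 1)]
    linarith
  calc Real.exp (-300) ≤ Real.exp (-(2 * 54)) * Real.exp (-(2 * 48)) := by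
        rw [← Real.exp_add, Real.exp_le_exp]; norm_num
    _ ≤ _ := mul_le_mul hA hB (Real.exp_pos _).le (Finset.prod_nonneg fun _ _ => norm_nonneg _)

/-- For `r` close to `1` there is a zero `1 - 8⁻ʲ` whose multiple by `r` is close to `1` but far
from all zeros. -/
lemma exists_good_zero {s : ℝ} (hs : 0 < s) (hs8 : s ≤ 8⁻¹) :
    ∃ j : ℕ, s / 64 ≤ 8⁻¹ ^ j ∧ (8⁻¹ : ℝ) ^ j ≤ s ∧
      Real.exp (-300) ≤
        ‖blaschke (fun n => 1 - 8⁻¹ ^ n) (((1 - s) * (1 - 8⁻¹ ^ j) : ℝ) : ℂ)‖ := by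
  -- The distance of r w_j to 1 is d = s + (1 - s) 8⁻ʲ, with 8⁻⁽ⁿ⁺¹⁾ < s ≤ 8⁻ⁿ.
  obtain ⟨n, hn1, hn2⟩ := exists_nat_pow_near_of_lt_one hs (by linarith : s ≤ 1)
    (by norm_num : (0 : ℝ) < 8⁻¹) (by norm_num)
  have hE : (0 : ℝ) < 8⁻¹ ^ n := by positivity
  have hn1' : (8⁻¹ : ℝ) ^ n * 8⁻¹ < s := by rwa [pow_succ] at hn1
  rcases le_total s (15 / 16 * 8⁻¹ ^ n) with h | h
  -- In units of 8⁻ⁿ, the shift lies between 7/512 and 1/64, so d stays below 1 by 15/16 + 1/64 = 1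
  -- - 3/64 and above 1/8 + 7/512 = (71/64)/8.
  · have e2 : (8⁻¹ : ℝ) ^ (n + 2) = 8⁻¹ ^ n / 64 := by rw [pow_add]; norm_num; ring
    have e1 : (8⁻¹ : ℝ) ^ (n + 1) = 8⁻¹ ^ n / 8 := by rw [pow_succ]; ring
    have e : ((1 - s) * (1 - 8⁻¹ ^ (n + 2)) : ℝ) =
        1 - (s + (1 - s) * (8⁻¹ ^ n / 64)) := by rw [e2]; ring
    refine ⟨n + 2, ?_, ?_, ?_⟩
    · rw [e2]; linarith
    · rw [e2]; linarith
    · rw [e]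
      have a1 : (1 - s) * ((8⁻¹ : ℝ) ^ n / 64) ≤ 8⁻¹ ^ n / 64 := by nlinarith
      have a2 : (7 / 8) * ((8⁻¹ : ℝ) ^ n / 64) ≤ (1 - s) * (8⁻¹ ^ n / 64) := by
        gcongr; linarith
      have hle : (8⁻¹ : ℝ) ^ n ≤ 1 := pow_le_one₀ (by norm_num) (by norm_num)
      refine exp_le_norm_blaschke n ?_ (by linarith) (by rw [e1]; linarith) (by linarith)
      rw [abs_sub_comm, abs_of_nonneg (by linarith)]
      linarith
  -- Now the shift lies between 7/64 and 1/8, pushing d beyond 8⁻ⁿ: 15/16 + 7/64 = 1 + 3/64, and d ≤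
  -- 9/8.
  · have e1 : (8⁻¹ : ℝ) ^ (n + 1) = 8⁻¹ ^ n / 8 := by rw [pow_succ]; ring
    have e : ((1 - s) * (1 - 8⁻¹ ^ (n + 1)) : ℝ) =
        1 - (s + (1 - s) * (8⁻¹ ^ n / 8)) := by rw [e1]; ring
    refine ⟨n + 1, ?_, hn1.le, ?_⟩
    · rw [e1]; linarith
    · rw [e]
      have a1 : (1 - s) * ((8⁻¹ : ℝ) ^ n / 8) ≤ 8⁻¹ ^ n / 8 := by nlinarith
      have a2 : (7 / 8) * ((8⁻¹ : ℝ) ^ n / 8) ≤ (1 - s) * (8⁻¹ ^ n / 8) := by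
        gcongr; linarith
      refine exp_le_norm_blaschke n ?_ (by linarith) (by rw [e1]; linarith) (by linarith)
      rw [abs_of_nonneg (by linarith)]
      linarith

/-! ### Adapting the parameters to the growth of γ. -/

/-- The choice of the parameters of `herg` adapted to the growth of `γ`. -/
lemma exists_delta {γ : ℝ → ℝ} (hγ : ∀ r ∈ Ioo (0 : ℝ) 1, 1 < γ r)
    (hγo : (fun r => Real.log (γ r)) =o[𝓝[<] (1 : ℝ)] fun r => (1 - r)⁻¹) :
    ∃ δ : ℕ → ℝ, (∀ n, 0 < δ n) ∧ ∃ ρ < 1, ∀ r ∈ Ioo (max ρ 0) 1, ∃ n, δ n ≤ 1 - r ∧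
      γ r ≤ (1 - r) ^ 3 * Real.exp (2⁻¹ ^ n / (3 * (1 - r))) := by
  have hlim : Tendsto (fun r => (1 - r) * (Real.log (γ r) - 3 * Real.log (1 - r)))
      (𝓝[<] (1 : ℝ)) (𝓝 0) := by
    have h1 : Tendsto (fun r => Real.log (γ r) / (1 - r)⁻¹) (𝓝[<] (1 : ℝ)) (𝓝 0) :=
      hγo.tendsto_div_nhds_zero
    have h2 : Tendsto (fun r : ℝ => (1 - r) * Real.log (1 - r)) (𝓝[<] (1 : ℝ)) (𝓝 0) := by
      have h3 := Real.continuous_mul_log.tendsto 0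
      simp only [zero_mul] at h3
      have h4 : Tendsto (fun r : ℝ => 1 - r) (𝓝[<] (1 : ℝ)) (𝓝 0) := by
        have : Tendsto (fun r : ℝ => 1 - r) (𝓝 1) (𝓝 (1 - 1)) :=
          Continuous.tendsto (by fun_prop) 1
        rw [sub_self] at this
        exact this.mono_left nhdsWithin_le_nhds
      exact h3.comp h4
    have h5 := h1.sub (h2.const_mul 3)
    rw [mul_zero, sub_zero] at h5
    refine h5.congr fun r => ?_
    rw [div_inv_eq_mul]
    ring
  have hex : ∀ n : ℕ, ∃ ρ < (1 : ℝ), 1 - 2⁻¹ ^ n ≤ ρ ∧ ∀ r ∈ Ioo ρ 1,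
      (1 - r) * (Real.log (γ r) - 3 * Real.log (1 - r)) ≤ 2⁻¹ ^ n / 3 := by
    intro n
    have h : ∀ᶠ r in 𝓝[<] (1 : ℝ),
        (1 - r) * (Real.log (γ r) - 3 * Real.log (1 - r)) ≤ 2⁻¹ ^ n / 3 :=
      (hlim.eventually_lt_const (by positivity)).mono fun _ => le_of_lt
    obtain ⟨l, hl, hl2⟩ := mem_nhdsLT_iff_exists_Ioo_subset.mp h
    refine ⟨max l (1 - 2⁻¹ ^ n), max_lt hl (by simp), le_max_right _ _, fun r hr => ?_⟩
    exact hl2 ⟨(le_max_left _ _).trans_lt hr.1, hr.2⟩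
  choose ρ hρ1 hρ2 hρ3 using hex
  -- The shift of index covers r by intervals: when n + 1 is the first m with r ≤ ρ_m, the estimate
  -- of level n holds at r because ρ_n < r, while r ≤ ρ_{n+1} says δ_n ≤ 1 - r.
  refine ⟨fun n => 1 - ρ (n + 1), fun n => by linarith [hρ1 (n + 1)], ρ 0, hρ1 0,
    fun r hr => ?_⟩
  have hr0 : 0 < r := (le_max_right _ _).trans_lt hr.1
  have hrρ : ρ 0 < r := (le_max_left _ _).trans_lt hr.1
  have hr1 : r < 1 := hr.2
  have hfin : ∃ m, r ≤ ρ m := by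
    obtain ⟨m, hm⟩ := exists_pow_lt_of_lt_one (by linarith : 0 < 1 - r)
      (by norm_num : (2⁻¹ : ℝ) < 1)
    exact ⟨m, by linarith [hρ2 m]⟩
  classical
  obtain ⟨n, hn⟩ : ∃ n, Nat.find hfin = n + 1 := by
    refine Nat.exists_eq_succ_of_ne_zero fun h => ?_
    have := Nat.find_spec hfin
    rw [h] at this
    linarith
  have h1 : r ≤ ρ (n + 1) := by
    have := Nat.find_spec hfin
    rwa [hn] at this
  have h2 : ρ n < r := not_le.mp (Nat.find_min hfin (by omega))
  refine ⟨n, by linarith, ?_⟩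
  have hs : 0 < 1 - r := by linarith
  have h3 := hρ3 n r ⟨h2, hr1⟩
  have hg : 0 < γ r := by linarith [hγ r ⟨hr0, hr1⟩]
  have h4 : Real.log (γ r) ≤ 3 * Real.log (1 - r) + 2⁻¹ ^ n / (3 * (1 - r)) := by
    have : Real.log (γ r) - 3 * Real.log (1 - r) ≤ 2⁻¹ ^ n / 3 / (1 - r) := by
      rw [le_div_iff₀ hs]; linarith
    rw [div_div] at this
    linarith
  calc γ r = Real.exp (Real.log (γ r)) := (Real.exp_log hg).symm
    _ ≤ Real.exp (3 * Real.log (1 - r) + 2⁻¹ ^ n / (3 * (1 - r))) := Real.exp_le_exp.mpr h4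
    _ = _ := by
      rw [Real.exp_add, mul_comm (3 : ℝ) (Real.log _), Real.exp_mul, Real.exp_log hs]
      norm_cast

/-! ### Series of kernels in H(b). -/

lemma inner_ker_toeplitz {F : ℂ → ℂ} (hF : BddLim F) {w : ℂ} (hw : ‖w‖ < 1) (x : H2) :
    inner ℂ (ker w hw) (toeplitz (bdry hF ∞) x) = F w * inner ℂ (ker w hw) x := by
  have h := inner_toeplitz (star (bdry hF ∞)) (ker w hw) x
  rw [star_star, toeplitz_star_ker] at h
  refine h.symm.trans ?_
  refine (inner_smul_left (𝕜 := ℂ) (E := H2) _ _ _).trans ?_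
  rw [Complex.conj_conj]

lemma norm_toeplitz_le_mulOp (ψ : LpT ∞) (x : H2) :
    ‖toeplitz ψ x‖ ≤ ‖mulOp ψ (x : LpT 2)‖ :=
  (hardy 2).norm_orthogonalProjectionOnto_apply_le _

section KernelSum

lemma one_sub_pow_mem (j : ℕ) : (1 - 8⁻¹ ^ j : ℝ) ∈ Ico (0 : ℝ) 1 :=
  ⟨sub_nonneg.mpr (pow_le_one₀ (by norm_num) (by norm_num)), by
    have : (0 : ℝ) < 8⁻¹ ^ j := by positivity
    linarith⟩

lemma norm_node_le {r : ℝ} (hr : r ∈ Icc (0 : ℝ) 1) (j : ℕ) :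
    ‖((r * (1 - 8⁻¹ ^ j) : ℝ) : ℂ)‖ ≤ 1 - 8⁻¹ ^ j := by
  have h := one_sub_pow_mem j
  rw [Complex.norm_real, Real.norm_of_nonneg (mul_nonneg hr.1 h.1)]
  exact mul_le_of_le_one_left h.1 hr.2

lemma norm_node_lt {r : ℝ} (hr : r ∈ Icc (0 : ℝ) 1) (j : ℕ) :
    ‖((r * (1 - 8⁻¹ ^ j) : ℝ) : ℂ)‖ < 1 :=
  (norm_node_le hr j).trans_lt (one_sub_pow_mem j).2

/-- The term with index `j` of the series `kerSum`. -/
def kerTerm {r : ℝ} (hr : r ∈ Icc (0 : ℝ) 1) (j : ℕ) : H2 :=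
  (((8⁻¹ ^ j) ^ 2 : ℝ) : ℂ) • ker _ (norm_node_lt hr j)

/-- The function `∑ 8⁻²ʲ k_{r wⱼ}` with `wⱼ = 1 - 8⁻ʲ`. -/
def kerSum {r : ℝ} (hr : r ∈ Icc (0 : ℝ) 1) : H2 := ∑' j, kerTerm hr j

variable {r : ℝ} (hr : r ∈ Icc (0 : ℝ) 1)

/-- The weights 8⁻²ʲ beat the kernel norms, at most 8ʲ, uniformly in r, including r = 1. -/
lemma sq_mul_norm_ker_le (j : ℕ) :
    (8⁻¹ ^ j) ^ 2 * ‖ker _ (norm_node_lt hr j)‖ ≤ 8⁻¹ ^ j := by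
  have h : (0 : ℝ) < 8⁻¹ ^ j := by positivity
  have h2 : ‖ker _ (norm_node_lt hr j)‖ ≤ (8⁻¹ ^ j)⁻¹ :=
    (norm_ker_le _ _).trans (inv_anti₀ h (by linarith [norm_node_le hr j]))
  calc _ ≤ (8⁻¹ ^ j : ℝ) ^ 2 * (8⁻¹ ^ j)⁻¹ := by gcongr
    _ = _ := by field_simp

lemma summable_geometric_eight : Summable fun j : ℕ => (8⁻¹ : ℝ) ^ j :=
  summable_geometric_of_lt_one (by norm_num) (by norm_num)

lemma hasSum_kerSum : HasSum (kerTerm hr) (kerSum hr) := by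
  refine (Summable.of_norm_bounded summable_geometric_eight fun j => ?_).hasSum
  refine le_trans (le_of_eq ?_) (sq_mul_norm_ker_le hr j)
  rw [kerTerm, norm_smul, Complex.norm_real, Real.norm_of_nonneg (by positivity)]

lemma hasSum_inner_kerSum (x : H2) :
    HasSum (fun j => (((8⁻¹ ^ j) ^ 2 : ℝ) : ℂ) * inner ℂ x (ker _ (norm_node_lt hr j)))
      (inner ℂ x (kerSum hr)) := by
  have h := (hasSum_kerSum hr).mapL (innerSL ℂ x)
  refine h.congr_fun fun j => ?_
  exact (inner_smul_right (𝕜 := ℂ) (E := H2) _ _ _).symm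

lemma hasSum_coeff_kerSum (n : ℕ) :
    HasSum (fun j => (((8⁻¹ ^ j) ^ 2 * (r * (1 - 8⁻¹ ^ j)) ^ n : ℝ) : ℂ))
      (coeff 2 n (kerSum hr : LpT 2)) := by
  rw [coeff_eq_inner_monomial]
  refine (hasSum_inner_kerSum hr (monomial n)).congr_fun fun j => ?_
  rw [← coeff_eq_inner_monomial, coeff_ker, Complex.conj_ofReal]
  push_cast
  ring

lemma dilate_kerSum (hr1 : r < 1) :
    dilate (kerSum (r := 1) ⟨zero_le_one, le_rfl⟩) r = kerSum hr := by
  refine H2_ext fun n => ?_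
  rw [coeff_dilate _ (by rw [abs_of_nonneg hr.1]; exact hr1)]
  refine HasSum.unique (((hasSum_coeff_kerSum _ n).mul_right _).congr_fun fun j => ?_)
    (hasSum_coeff_kerSum hr n)
  rw [mul_pow r]
  push_cast
  ring

end KernelSum

/-- The space `H(b)` contains `∑ 8⁻²ʲ k_{r wⱼ}` for `r < 1`. -/
lemma kerSum_mem_space {b : HInf} (hb : ‖b‖ ≤ 1) {A : ℂ → ℂ}
    (hA : DiffContOnCl ℂ A (Metric.ball 0 1)) (hA0 : ∀ z, ‖z‖ < 1 → A z ≠ 0)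
    (h : ∀ᵐ t ∂(AddCircle.haarAddCircle : Measure UnitAddCircle),
      ‖A (circ t)‖ ^ 2 + ‖(b : LpT ∞) t‖ ^ 2 ≤ 1)
    {r : ℝ} (hr : r ∈ Icc (0 : ℝ) 1) (hr1 : r < 1) : kerSum hr ∈ space b := by
  obtain ⟨M, hM⟩ := (isCompact_closedBall (0 : ℂ) r).exists_bound_of_continuousOn
    (f := fun z => (A z)⁻¹) (((hA.continuousOn_ball).mono
      (Metric.closedBall_subset_closedBall hr.2)).inv₀ fun z hz => hA0 z
        ((mem_closedBall_zero_iff.mp hz).trans_lt hr1))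
  have hM0 : 0 ≤ M := (norm_nonneg _).trans (hM 0 (by simpa using hr.1))
  have hA' : ∀ᵐ t ∂(AddCircle.haarAddCircle : Measure UnitAddCircle),
      ‖bdry hA.bddLim ∞ t‖ ^ 2 + ‖(b : LpT ∞) t‖ ^ 2 ≤ 1 := by
    filter_upwards [h, bdry_coe hA.bddLim ∞] with t h1 h2
    rwa [h2]
  -- x(z) = (Ax)(z)/A(z), and ‖Ax‖ ≤ ‖D^{1/2} x‖, so evaluation at z is controlled by ‖D^{1/2} x‖.
  have key : ∀ (x : H2) (z : ℂ) (hz : ‖z‖ < 1), ‖z‖ ≤ r →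
      ‖inner ℂ x (ker z hz)‖ ≤ ‖ker z hz‖ * (M * ‖defectSqrt b x‖) := by
    intro x z hz hzr
    have e := inner_ker_toeplitz hA.bddLim hz x
    have e2 : ‖inner ℂ x (ker z hz)‖ =
        ‖(A z)⁻¹‖ * ‖inner ℂ (ker z hz) (toeplitz (bdry hA.bddLim ∞) x)‖ := by
      rw [e, ← norm_mul, inv_mul_cancel_left₀ (hA0 z hz)]
      exact norm_inner_symm (𝕜 := ℂ) (E := H2) _ _
    rw [e2]
    have h3 : ‖inner ℂ (ker z hz) (toeplitz (bdry hA.bddLim ∞) x)‖ ≤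
        ‖ker z hz‖ * ‖defectSqrt b x‖ :=
      (norm_inner_le_norm (𝕜 := ℂ) (E := H2) _ _).trans (by
        gcongr
        exact (norm_toeplitz_le_mulOp _ _).trans (norm_mulOp_le_norm_defectSqrt hb hA' x))
    calc _ ≤ M * (‖ker z hz‖ * ‖defectSqrt b x‖) := by
          gcongr
          exact hM z (by simpa using hzr)
      _ = _ := by ring
  refine mem_space_of_norm_inner_le (C := (∑' j : ℕ, (8⁻¹ : ℝ) ^ j) * M) fun x => ?_
  have hs := hasSum_inner_kerSum hr x
  have e : ‖inner ℂ (kerSum hr) x‖ = ‖inner ℂ x (kerSum hr)‖ :=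
    norm_inner_symm (𝕜 := ℂ) (E := H2) _ _
  rw [e, mul_assoc]
  refine hs.norm_le_of_bounded (summable_geometric_eight.hasSum.mul_right _) fun j => ?_
  rw [norm_mul, Complex.norm_real, Real.norm_of_nonneg (by positivity)]
  have hj := one_sub_pow_mem j
  have hnode : ‖((r * (1 - 8⁻¹ ^ j) : ℝ) : ℂ)‖ ≤ r := by
    rw [Complex.norm_real, Real.norm_of_nonneg (mul_nonneg hr.1 hj.1)]
    exact mul_le_of_le_one_right hr.1 hj.2.le
  calc _ ≤ (8⁻¹ ^ j : ℝ) ^ 2 * (‖ker _ (norm_node_lt hr j)‖ * (M * ‖defectSqrt b x‖)) := by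
        gcongr
        exact key x _ _ hnode
    _ = ((8⁻¹ ^ j : ℝ) ^ 2 * ‖ker _ (norm_node_lt hr j)‖) * (M * ‖defectSqrt b x‖) := by ring
    _ ≤ _ := by
        gcongr
        exact sq_mul_norm_ker_le hr j

/-- b is the midpoint of b + g and b - g, both in the unit ball. -/
lemma nonExtreme_of_norm_add_le {b g : HInf} (hg : g ≠ 0)
    (h : ∀ᵐ t ∂(AddCircle.haarAddCircle : Measure UnitAddCircle),
      ‖(b : LpT ∞) t‖ + ‖(g : LpT ∞) t‖ ≤ 1) : NonExtreme b := by
  refine ⟨?_, fun hx => ?_⟩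
  · rw [mem_closedBall_zero_iff]
    refine norm_hardy_le_of_ae zero_le_one ?_
    filter_upwards [h] with t ht
    linarith [norm_nonneg ((g : LpT ∞) t)]
  · have h1 : b + g ∈ Metric.closedBall (0 : HInf) 1 := by
      rw [mem_closedBall_zero_iff]
      refine norm_hardy_le_of_ae zero_le_one ?_
      filter_upwards [h, Lp.coeFn_add (b : LpT ∞) (g : LpT ∞)] with t ht h2
      change ‖((b : LpT ∞) + (g : LpT ∞) : LpT ∞) t‖ ≤ 1
      rw [h2]
      exact (norm_add_le _ _).trans ht
    have h2 : b - g ∈ Metric.closedBall (0 : HInf) 1 := by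
      rw [mem_closedBall_zero_iff]
      refine norm_hardy_le_of_ae zero_le_one ?_
      filter_upwards [h, Lp.coeFn_sub (b : LpT ∞) (g : LpT ∞)] with t ht h2
      change ‖((b : LpT ∞) - (g : LpT ∞) : LpT ∞) t‖ ≤ 1
      rw [h2]
      exact (norm_sub_le _ _).trans ht
    have h3 := hx.2 h1 h2 ⟨2⁻¹, 2⁻¹, by norm_num, by norm_num, by norm_num, by module⟩
    have h4 : b + g = b := h3
    exact hg (by simpa using h4)

/-- Used with u = |A|, where |b| = exp(-u²). The companion estimates give room for A²/2 around b and
bound 1 - |b|² by 2|A|². -/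
lemma exp_neg_sq_add_le {u : ℝ} (h0 : 0 ≤ u) (h1 : u ≤ 2⁻¹) :
    u ^ 2 + Real.exp (-u ^ 2) ^ 2 ≤ 1 := by
  have hw : u ^ 2 ≤ 4⁻¹ := by nlinarith
  have h2 : Real.exp (-u ^ 2) ^ 2 = (Real.exp (2 * u ^ 2))⁻¹ := by
    rw [← Real.exp_nat_mul, ← Real.exp_neg]; congr 1; push_cast; ring
  have h3 := Real.add_one_le_exp (2 * u ^ 2)
  have h4 : (Real.exp (2 * u ^ 2))⁻¹ ≤ (2 * u ^ 2 + 1)⁻¹ := inv_anti₀ (by positivity) h3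
  have h5 : (2 * u ^ 2 + 1)⁻¹ ≤ 1 - u ^ 2 := by
    rw [inv_le_iff_one_le_mul₀ (by positivity)]
    nlinarith [sq_nonneg u]
  rw [h2]; linarith

lemma exp_neg_add_le {u : ℝ} (h0 : 0 ≤ u) (h1 : u ≤ 2⁻¹) :
    Real.exp (-u ^ 2) + u ^ 2 / 2 ≤ 1 := by
  have hw : u ^ 2 ≤ 4⁻¹ := by nlinarith
  have h3 := Real.add_one_le_exp (u ^ 2)
  have h4 : (Real.exp (u ^ 2))⁻¹ ≤ (u ^ 2 + 1)⁻¹ := inv_anti₀ (by positivity) h3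
  have h5 : (u ^ 2 + 1)⁻¹ ≤ 1 - u ^ 2 / 2 := by
    rw [inv_le_iff_one_le_mul₀ (by positivity)]
    nlinarith [sq_nonneg u]
  rw [Real.exp_neg]; linarith

lemma one_sub_exp_neg_sq_le (u : ℝ) : 1 - Real.exp (-u ^ 2) ^ 2 ≤ 2 * u ^ 2 := by
  have h2 : Real.exp (-u ^ 2) ^ 2 = Real.exp (-(2 * u ^ 2)) := by
    rw [← Real.exp_nat_mul]; congr 1; push_cast; ring
  have := Real.add_one_le_exp (-(2 * u ^ 2))
  rw [h2]; linarith

/-- A function with nonnegative values at the nodes pairs with `∑ 8⁻²ʲ k_{r wⱼ}` without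
cancellation. -/
lemma le_norm_inner_kerSum {r : ℝ} (hr : r ∈ Icc (0 : ℝ) 1) {x : H2}
    (hx : ∀ j, ∃ v : ℝ, 0 ≤ v ∧ inner ℂ x (ker _ (norm_node_lt hr j)) = v) (j : ℕ) :
    (8⁻¹ ^ j) ^ 2 * ‖inner ℂ x (ker _ (norm_node_lt hr j))‖ ≤ ‖inner ℂ (kerSum hr) x‖ := by
  choose v hv0 hv using hx
  have h := hasSum_inner_kerSum hr x
  simp_rw [hv] at h
  have e : ‖inner ℂ (kerSum hr) x‖ = ‖inner ℂ x (kerSum hr)‖ :=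
    norm_inner_symm (𝕜 := ℂ) (E := H2) _ _
  rw [hv, e, Complex.norm_real, Real.norm_of_nonneg (hv0 j)]
  have h2 := Complex.hasSum_re h
  simp only [← Complex.ofReal_mul, Complex.ofReal_re] at h2
  refine le_trans ?_ (Complex.re_le_norm _)
  exact le_hasSum h2 j fun k _ => mul_nonneg (by positivity) (hv0 k)

lemma toeplitz_star_kerSum_eq_zero {F : ℂ → ℂ} (hF : BddLim F) {r : ℝ} (hr : r ∈ Icc (0 : ℝ) 1)
    (h : ∀ j : ℕ, F ((r * (1 - 8⁻¹ ^ j) : ℝ) : ℂ) = 0) :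
    toeplitz (star (bdry hF ∞)) (kerSum hr) = 0 := by
  refine ((hasSum_kerSum hr).mapL (toeplitz (star (bdry hF ∞)))).unique ?_
  refine hasSum_zero.congr_fun fun j => ?_
  rw [kerTerm, map_smul, toeplitz_star_ker, h, map_zero, zero_smul, smul_zero]

lemma mulOp_bdry_bdryH_mem {F G : ℂ → ℂ} (hF : BddLim F)
    (hG : DiffContOnCl ℂ G (Metric.ball 0 1)) :
    mulOp (bdry hF ∞) (bdryH hG.bddLim 2 : LpT 2) ∈ hardy 2 := by
  have e : mulOp (bdry hF ∞) (bdryH hG.bddLim 2 : LpT 2) = bdry (hF.mul hG) 2 := by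
    refine Lp.ext ?_
    filter_upwards [mulOp_coe (bdry hF ∞) (bdryH hG.bddLim 2 : LpT 2), bdry_coe hF ∞,
      bdry_coe hG.bddLim 2, bdry_coe (hF.mul hG) 2] with t h1 h2 h3 h4
    rw [h1, h2, h4]
    congr 1
  rw [e]
  exact bdry_mem_hardy _ _

lemma inner_toeplitz_bdryH_ker {F G : ℂ → ℂ} (hF : BddLim F)
    (hG : DiffContOnCl ℂ G (Metric.ball 0 1)) {w : ℂ} (hw : ‖w‖ < 1) {v : ℝ}
    (h : F w * G w = v) :
    inner ℂ (toeplitz (bdry hF ∞) (bdryH hG.bddLim 2)) (ker w hw) = v := by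
  refine (inner_conj_symm (𝕜 := ℂ) (E := H2) _ _).symm.trans ?_
  rw [inner_ker_toeplitz, inner_ker_bdryH, h, Complex.conj_ofReal]

end DBR

end

/-! ### Assembling b, f and the test functions. -/

theorem mainTheorem4 (γ : ℝ → ℝ) (hγ : ∀ r ∈ Ioo (0 : ℝ) 1, 1 < γ r)
    (hγo : (fun r => Real.log (γ r)) =o[𝓝[<] (1 : ℝ)] fun r => (1 - r)⁻¹) :
    ∃ b : DBR.HInf, DBR.NonExtreme b ∧ ∃ f ∈ DBR.space b,
      ∃ r₀ ∈ Ioo (0 : ℝ) 1, ∀ r ∈ Ioo r₀ 1,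
        DBR.dilate f r ∈ DBR.space b ∧ γ r ≤ DBR.hbNorm b (DBR.dilate f r) := by
  open DBR in
  obtain ⟨δ, hδ, ρ, hρ, hmain⟩ := exists_delta hγ hγo
  obtain ⟨A, q, Q, hA, hq, hQ, him, hre, hA0, hA2, hy, hAy⟩ := exists_mate hδ
  have hw0 := fun j => (one_sub_pow_mem j).1
  have hw1 := fun j => (one_sub_pow_mem j).2
  have hws : Summable fun j : ℕ => 1 - (1 - (8⁻¹ : ℝ) ^ j) := by
    simpa using summable_geometric_eight
  have hg : DiffContOnCl ℂ (fun z => Complex.exp (-q z)) (Metric.ball 0 1) :=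
    ⟨hq.1.neg.cexp, hq.2.neg.cexp⟩
  set B : ℂ → ℂ := blaschke fun j => 1 - 8⁻¹ ^ j
  have hF : BddLim fun z => B z ^ 2 * Complex.exp (-q z) :=
    bddLim_blaschke_sq_mul hw0 hw1 hws hg
  set b : HInf := bdryH hF ∞
  have hbA : ∀ᵐ t ∂(AddCircle.haarAddCircle : Measure UnitAddCircle),
      ‖(b : LpT ∞) t‖ = Real.exp (-‖A (circ t)‖ ^ 2) := by
    filter_upwards [bdry_coe hF ∞, ae_circ_ne_one] with t h1 h2
    change ‖bdry hF ∞ t‖ = _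
    rw [h1, norm_mul, norm_pow, norm_blaschke_eq_one hw0 hw1 hws h2 (norm_circ t), one_pow,
      one_mul, Complex.norm_exp, Complex.neg_re, hre _ (norm_circ t)]
  have hAt : ∀ t, ‖A (circ t)‖ ≤ 2⁻¹ := fun t => hA2 _ (norm_circ t).le
  have hAA : DiffContOnCl ℂ (fun z => A z * (2⁻¹ * A z)) (Metric.ball 0 1) :=
    diffContOnCl_mul hA (diffContOnCl_mul diffContOnCl_const hA)
  -- The perturbation is A²/2, nonzero because A(0) ≠ 0.
  have hne : NonExtreme b := by
    refine nonExtreme_of_norm_add_le (g := bdryH hAA.bddLim ∞) (fun h => ?_) ?_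
    · have h1 := coeff_bdry_zero hAA.bddLim ∞
      have h2 : bdry hAA.bddLim ∞ = 0 := congrArg Subtype.val h
      rw [h2, map_zero] at h1
      have := hA0 0 (by simp)
      simp [this] at h1
    · filter_upwards [hbA, bdry_coe hAA.bddLim ∞] with t h1 h2
      have h3 : ‖(bdryH hAA.bddLim ∞ : LpT ∞) t‖ = ‖A (circ t)‖ ^ 2 / 2 := by
        change ‖bdry hAA.bddLim ∞ t‖ = _
        rw [h2, norm_mul, norm_mul, norm_inv, Complex.norm_ofNat]
        ring
      rw [h1, h3]
      exact exp_neg_add_le (norm_nonneg _) (hAt t)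
  have hb1 : ‖b‖ ≤ 1 := mem_closedBall_zero_iff.mp hne.1
  have hfmem : kerSum (r := 1) ⟨zero_le_one, le_rfl⟩ ∈ space b := by
    refine mem_space_of_toeplitz_star_eq_zero hb1 (toeplitz_star_kerSum_eq_zero hF _ fun j => ?_)
    have : B ((1 - 8⁻¹ ^ j : ℝ) : ℂ) = 0 := blaschke_zero (w := fun j => 1 - 8⁻¹ ^ j) j
    simp only [one_mul]
    rw [this, zero_pow two_ne_zero, zero_mul]
  refine ⟨b, hne, _, hfmem, ?_⟩
  -- κ collects the losses in the chosen term: |B|² ≥ exp(-300)², exp(-Re q) ≥ exp(-Q), and the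
  -- weight 8⁻²ʲ ≥ ((1 - r)/64)², with 64² = 4096. Taking 1 - r < κ lets the third factor 1 - r from
  -- `exists_delta` absorb it.
  set κ : ℝ := Real.exp (-300) ^ 2 * Real.exp (-Q) / 4096 with hκ
  have hκ0 : 0 < κ := by positivity
  set r₀ : ℝ := max (max ρ (7 / 8)) (1 - κ)
  have hr₀1 : r₀ < 1 := max_lt (max_lt hρ (by norm_num)) (by linarith)
  have hr₀2 : ρ ≤ r₀ := (le_max_left _ _).trans (le_max_left _ _)
  have hr₀3 : 7 / 8 ≤ r₀ := (le_max_right _ _).trans (le_max_left _ _)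
  have hr₀4 : 1 - κ ≤ r₀ := le_max_right _ _
  refine ⟨r₀, ⟨by linarith, hr₀1⟩, fun r hr => ?_⟩
  have hr0 : 0 < r := by linarith [hr.1]
  have hr1 : r < 1 := hr.2
  have hrI : r ∈ Icc (0 : ℝ) 1 := ⟨hr0.le, hr1.le⟩
  rw [dilate_kerSum hrI hr1]
  have hmem : kerSum hrI ∈ space b := by
    refine kerSum_mem_space hb1 hA hA0 ?_ hrI hr1
    filter_upwards [hbA] with t ht
    rw [ht]
    exact exp_neg_sq_add_le (norm_nonneg _) (hAt t)
  refine ⟨hmem, ?_⟩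
  obtain ⟨n, hn1, hn2⟩ := hmain r ⟨max_lt (by linarith [hr.1]) hr0, hr1⟩
  have hs : 0 < 1 - r := by linarith
  obtain ⟨j, hj1, hj2, hj3⟩ := exists_good_zero hs (by linarith [hr.1])
  rw [sub_sub_cancel] at hj3
  set y : H2 := bdryH (hy n).bddLim 2
  have hTx : ‖defectSqrt b (toeplitz (b : LpT ∞) y)‖ ≤ 1 := by
    refine norm_defectSqrt_toeplitz_le hb1 (mulOp_bdry_bdryH_mem hF (hy n)) ?_
    filter_upwards [hbA, bdry_coe (hy n).bddLim 2] with t h1 h2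
    have h3 : ((y : H2) : LpT 2) t =
      Complex.exp ((2⁻¹ : ℂ) ^ n * (1 + δ n - circ t)⁻¹) := h2
    have h4 := hAy n _ (norm_circ t).le
    rw [norm_mul] at h4
    rw [h1, h3]
    set Y := ‖Complex.exp ((2⁻¹ : ℂ) ^ n * (1 + δ n - circ t)⁻¹)‖
    calc _ ≤ 2 * ‖A (circ t)‖ ^ 2 * Y ^ 2 := by
          gcongr
          exact one_sub_exp_neg_sq_le _
      _ = 2 * (‖A (circ t)‖ * Y) ^ 2 := by ring
      _ ≤ 2 * 2⁻¹ ^ 2 := by gcongr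
      _ ≤ 1 := by norm_num
  refine le_trans ?_ (norm_inner_le_hbNorm_mul hmem _ hTx)
  -- B is real on (-1, 1), so squaring it gives b ≥ 0 there; this is why b carries B² rather than B.
  have hval : ∀ x : ℝ, |x| < 1 → B x ^ 2 * Complex.exp (-q x) *
      Complex.exp ((2⁻¹ : ℂ) ^ n * (1 + (δ n : ℂ) - (x : ℂ))⁻¹) =
      ((‖B x‖ ^ 2 * Real.exp (-(q x).re) * Real.exp (2⁻¹ ^ n * (1 + δ n - x)⁻¹) : ℝ) : ℂ) := by
    intro x hx
    have hB : B x = ((B x).re : ℂ) := Complex.ext rfl (blaschke_im hw0 hw1 hws hx)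
    have hqx : q x = ((q x).re : ℂ) := Complex.ext rfl (him x)
    have hB2 : ‖B x‖ ^ 2 = (B x).re ^ 2 := by
      rw [hB, Complex.norm_real, Real.norm_eq_abs, sq_abs, Complex.ofReal_re]
    rw [hB2]
    rw [hB, hqx]
    push_cast
    simp only [Complex.ofReal_re]
  have habs : ∀ i : ℕ, |r * (1 - 8⁻¹ ^ i)| < 1 := fun i => by
    simpa only [Complex.norm_real, Real.norm_eq_abs] using norm_node_lt hrI i
  have hin := fun i => inner_toeplitz_bdryH_ker hF (hy n) (norm_node_lt hrI i) (hval _ (habs i))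
  refine le_trans ?_ (le_norm_inner_kerSum hrI (x := toeplitz (b : LpT ∞) y)
    (fun i => ⟨_, by positivity, hin i⟩) j)
  have hin_j : inner ℂ (toeplitz (b : LpT ∞) y) (ker _ (norm_node_lt hrI j)) = _ := hin j
  rw [hin_j, Complex.norm_real, Real.norm_of_nonneg (by positivity)]
  set x : ℝ := r * (1 - 8⁻¹ ^ j) with hx
  have hqx : (q x).re ≤ Q := (Complex.re_le_norm _).trans (hQ _ (norm_node_lt hrI j).le)
  have hden0 : 0 < 1 + δ n - x := by linarith [hδ n, (abs_lt.mp (habs j)).2]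
  -- Each of δ_n, 1 - r and r 8⁻ʲ is at most 1 - r.
  have hden : 1 + δ n - x ≤ 3 * (1 - r) := by
    rw [hx]
    have : (0 : ℝ) < 8⁻¹ ^ j := by positivity
    nlinarith
  calc γ r ≤ (1 - r) ^ 3 * Real.exp (2⁻¹ ^ n / (3 * (1 - r))) := hn2
    _ ≤ ((1 - r) ^ 2 * κ) * Real.exp (2⁻¹ ^ n / (3 * (1 - r))) := by
        gcongr
        rw [pow_succ]
        gcongr
        linarith [hr.1]
    _ = ((1 - r) / 64) ^ 2 * (Real.exp (-300) ^ 2 * Real.exp (-Q) *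
          Real.exp (2⁻¹ ^ n * (3 * (1 - r))⁻¹)) := by
        rw [hκ, div_eq_mul_inv (2⁻¹ ^ n)]; ring
    _ ≤ _ := by gcongr
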